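/- **Setting.** An instance consists of $n\ge 2$ nodes $v_1,\dots,v_n$ with scalars $\alpha_1<\dots<\alpha_n$ and $m$ undirected edges with weights $w_e\ge 0$. For a nonempty set $B$ of nodes, $\mathrm{range}(B)$ is the largest minus the smallest scalar in $B$; $C(S,\bar S)$ is the total weight of the edges with exactly one endpoint in $S$. The *min range cut problem* is to minimise $\mathrm{range}(S)+\mathrm{range}(\bar S)+C(S,\bar S)$ over all partitions $(S,\bar S)$ of the nodes into two nonempty sets. A *parametric network* is an $s,t$-network whose arc capacities in $[0,\infty]$ are given for a list of $q$ parameter values, such that along the list the capacities of source-adjacent arcs are nondecreasing, those of sink-adjacent arcs are nonincreasing, and all others are constant. A *parametric cut procedure* returns, for each parameter value, a minimum $s,t$-cut together with its capacity. A *cut time with constant $D$* is a function $T:\mathbb N^2\to\mathbb N$ that is nondecreasing in both arguments and satisfies $T(m,n)\ge m+n$ and $T(2(m+n),2n)\le D\,T(m,n)$ for all $m,n$. **Min Range Cut Algorithm.** Start with $z^*=\infty$. 1. For $i=1,\dots,n-1$: let $G(i)$ be the graph with source $v_1$ and sink $v_n$ in which $v_{i+1},\dots,v_n$ are shrunk into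 the sink; for $j=2,\dots,i+1$ shrink in addition $v_1,\dots,v_{j-1}$ into the source (this treats the interval pair $[\alpha_1,\alpha_i],[\alpha_j,\alpha_n]$). One parametric cut call gives minimum cuts $(S_j,\bar S_j)$ for all these $j$. Let $j$ minimise $z(j)=(\alpha_i-\alpha_1)+(\alpha_n-\alpha_j)+C(S_j,\bar S_j)$; if $z(j)<z^*$, put $S^*:=S_j$, $z^*:=z(j)$. 2. For $i=2,\dots,n-1$: let $G(i)$ be the graph with sink $v_i$ and source $v_1$ in which $v_{i+1},\dots,v_n$ are shrunk into the source; for $j=2,\dots,i$ shrink in addition $v_1,\dots,v_{j-1}$ into the source (this treats the interval pair $[\alpha_1,\alpha_n],[\alpha_j,\alpha_i]$). Proceed as in 1 with $z(j)=(\alpha_n-\alpha_1)+(\alpha_i-\alpha_j)+C(S_j,\bar S_j)$. Shrinking a node into $s$ or $t$ means joining it to $s$ or $t$ by an arc of infinite capacity. **Theorem.** (a) With any parametric cut procedure, the Min Range Cut Algorithm returns an optimal partition $(S^*,\bar S^*)$ of the min range cut problem and its value $z^*$. It makes at most $2n$ parametric cut calls, on networks with $n$ nodes, at most $2(m+n)$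 arcs and at most $n$ parameter values; the calls together treat at most $n^2$ pairs of intervals. Outside these calls it takes $O(n(m+n))$ steps. Hence, if $T$ is a cut time with constant $D$ and a parametric cut call with $q\le n$ parameter values on a network with $m$ arcs and $n$ nodes takes at most $K\,T(m,n)$ steps, then the algorithm takes $O(n\,T(m,n))$ steps in total, with a constant that depends only on $D$ and $K$. (b) The min range cut problem can be solved in $O(n\,T(m,n))$ steps, where $T(m,n)$ is the cost of one minimum $s,t$-cut. Precisely, there is a program for the real random access machine (unit-cost additions, subtractions and comparisons) with a subroutine for minimum $s,t$-cuts such that, for every $D$, every cut time $T$ with constant $D$, every minimum $s,t$-cut procedure used as the subroutine and charged $T(m',n')$ steps on a network with $m'$ arcs and $n'$ nodes, and every instance, the program halts with an optimal partition and its value after at most $c_D\, n\,T(m,n)$ steps, where $c_D$ depends only on $D$. -/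

import Mathlib

open scoped NNReal ENNReal

noncomputable section

namespace RangeCut

/-! ### The min range cut problem -/

/-- An undirected edge `[u, v]` with a nonnegative similarity weight. -/
structure Edge (n : ℕ) where
  u : Fin n
  v : Fin n
  weight : ℝ≥0

/-- An instance: nodes `0, …, n-1` with strictly increasing scalars `α`, and a list of `m`
weighted undirected edges (loops and parallel edges are harmless and not excluded). -/
structure Instance where
  n : ℕ
  two_le : 2 ≤ n
  edges : List (Edge n)
  α : Fin n → ℝ
  strictMono : StrictMono α

namespace Instance

/-- The number of edges. -/
def m (I : Instance) : ℕ := I.edges.length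

/-- The capacity `C(S, Sᶜ)`: total weight of the edges with exactly one endpoint in `S`. -/
def cut (I : Instance) (S : Finset (Fin I.n)) : ℝ≥0 :=
  (I.edges.map fun e =>
    if (e.u ∈ S ∧ e.v ∉ S) ∨ (e.v ∈ S ∧ e.u ∉ S) then e.weight else 0).sum

/-- `max(B) - min(B)` for a nonempty set `B` (and the irrelevant value `0` for the empty set). -/
def range (I : Instance) (B : Finset (Fin I.n)) : ℝ :=
  if h : B.Nonempty then B.sup' h I.α - B.inf' h I.α else 0

/-- `range(S) + range(Sᶜ) + C(S, Sᶜ)`. -/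
def objective (I : Instance) (S : Finset (Fin I.n)) : ℝ :=
  I.range S + I.range Sᶜ + I.cut S

/-- `(S, Sᶜ)` is a partition into two nonempty clusters which is optimal among all of them. -/
def IsMinRangeCut (I : Instance) (S : Finset (Fin I.n)) : Prop :=
  S.Nonempty ∧ Sᶜ.Nonempty ∧
    ∀ S' : Finset (Fin I.n), S'.Nonempty → S'ᶜ.Nonempty → I.objective S ≤ I.objective S'

end Instance

/-! ### Minimum `s,t`-cuts -/

/-- A directed arc with a label `cap` (a capacity, or a family of capacities). -/
structure Arc (n : ℕ) (R : Type) where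
  tail : Fin n
  head : Fin n
  cap : R

/-- The capacity of the arcs that leave `S`. -/
def cutCapacity {n : ℕ} {R : Type} [AddCommMonoid R] (arcs : List (Arc n R))
    (S : Finset (Fin n)) : R :=
  (arcs.map fun a => if a.tail ∈ S ∧ a.head ∉ S then a.cap else 0).sum

/-- `S` is the source set of a minimum `s,t`-cut. -/
def IsMinSTCut {n : ℕ} {R : Type} [AddCommMonoid R] [LE R] (arcs : List (Arc n R))
    (s t : Fin n) (S : Finset (Fin n)) : Prop :=
  s ∈ S ∧ t ∉ S ∧
    ∀ S' : Finset (Fin n), s ∈ S' → t ∉ S' → cutCapacity arcs S ≤ cutCapacity arcs S'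

/-- A bound `T m n` on the cost of one minimum `s,t`-cut on a network with at most `m` arcs and
at most `n` nodes: it is monotone, at least the size of the network, and changes by at most a
constant factor when the size of the network does. -/
structure IsCutTime (T : ℕ → ℕ → ℕ) (D : ℕ) : Prop where
  mono : ∀ m m' n n', m ≤ m' → n ≤ n' → T m n ≤ T m' n'
  size_le : ∀ m n, m + n ≤ T m n
  growth : ∀ m n, T (2 * (m + n)) (2 * n) ≤ D * T m n

/-! ### Parametric cuts -/

/-- An `s,t`-network on `n` nodes whose arc capacities are given for `q` parameter values. -/
structure ParamNetwork (n q : ℕ) where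
  arcs : List (Arc n (Fin q → ℝ≥0∞))
  source : Fin n
  sink : Fin n

namespace ParamNetwork

variable {n q : ℕ}

/-- The arcs with their capacities at the parameter value `l`. -/
def arcsAt (G : ParamNetwork n q) (l : Fin q) : List (Arc n ℝ≥0∞) :=
  G.arcs.map fun a => ⟨a.tail, a.head, a.cap l⟩

/-- Source-adjacent capacities are nondecreasing in the parameter, sink-adjacent capacities are
nonincreasing, all other capacities are constant. -/
def IsParametric (G : ParamNetwork n q) : Prop :=
  G.source ≠ G.sink ∧ ∀ a ∈ G.arcs,
    (a.tail = G.source → a.head ≠ G.sink → Monotone a.cap) ∧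
    (a.head = G.sink → a.tail ≠ G.source → Antitone a.cap) ∧
    ((a.tail = G.source ↔ a.head = G.sink) → ∀ l l', a.cap l = a.cap l')

end ParamNetwork

/-- A procedure for the parametric cut problem: for each parameter value it returns a set and a
capacity; `time` is the number of steps that it takes. -/
structure ParamCutProcedure where
  run : ∀ {n q : ℕ}, ParamNetwork n q → Fin q → Finset (Fin n) × ℝ≥0∞
  time : ∀ {n q : ℕ}, ParamNetwork n q → ℕ

/-- On each parametric network the procedure returns a minimum `s,t`-cut, with its capacity, for
every parameter value. -/
def ParamCutProcedure.Correct (P : ParamCutProcedure) : Prop :=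
  ∀ {n q : ℕ} (G : ParamNetwork n q), G.IsParametric → ∀ l : Fin q,
    IsMinSTCut (G.arcsAt l) G.source G.sink (P.run G l).1 ∧
      (P.run G l).2 = cutCapacity (G.arcsAt l) (P.run G l).1

/-! ### The Min Range Cut Algorithm, with its steps counted -/

/-- The size of a network passed to the parametric cut procedure. -/
structure CallSize where
  nodes : ℕ
  arcs : ℕ
  values : ℕ

/-- What has been spent so far: steps of the algorithm itself, steps inside the parametric cut
procedure, and the list of the calls. -/
structure Ledger where
  ownSteps : ℕ
  callSteps : ℕ
  calls : List CallSize

def Ledger.empty : Ledger := ⟨0, 0, []⟩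

/-- All steps. -/
def Ledger.steps (L : Ledger) : ℕ := L.ownSteps + L.callSteps

/-- Computations that keep a ledger. -/
abbrev Counted (β : Type) := StateM Ledger β

def tick (k : ℕ) : Counted Unit :=
  modify fun L => { L with ownSteps := L.ownSteps + k }

def parametricCut (P : ParamCutProcedure) {n q : ℕ} (G : ParamNetwork n q) :
    Counted (Fin q → Finset (Fin n) × ℝ≥0∞) := do
  modify fun L => { L with
    callSteps := L.callSteps + P.time G
    calls := L.calls ++ [⟨n, G.arcs.length, q⟩] }
  return P.run G

open Classical in
/-- The graph of the instance as an `s,t`-network in which, at the parameter value `l`, the nodes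
of `X l` are shrunk into `s` and the nodes of `Y` into `t`; shrinking a node into `s` or `t` is
done by an arc of infinite capacity. -/
def shrink (I : Instance) {q : ℕ} (s t : Fin I.n) (X : Fin q → Fin I.n → Prop)
    (Y : Fin I.n → Prop) : ParamNetwork I.n q where
  arcs :=
    I.edges.map (fun e => ⟨e.u, e.v, fun _ => e.weight⟩) ++
    I.edges.map (fun e => ⟨e.v, e.u, fun _ => e.weight⟩) ++
    (List.finRange I.n).map (fun v => ⟨s, v, fun l => if X l v then ⊤ else 0⟩) ++
    (List.finRange I.n).map (fun v => ⟨v, t, fun _ => if Y v then ⊤ else 0⟩)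
  source := s
  sink := t

open Classical in
/-- One iteration of an outer loop: create the network and its sequence of shrinkings, call
parametric cut, find the parameter value `l` that minimizes `z(l) = rangeSum l + C(S_l)`, and
replace the incumbent if `z(l)` is smaller. -/
def iteration (P : ParamCutProcedure) {n q : ℕ} (G : ParamNetwork n q) (rangeSum : Fin q → ℝ)
    (best : Option (Finset (Fin n) × ℝ)) : Counted (Option (Finset (Fin n) × ℝ)) := do
  -- creating the network, then shrinking one more node for each parameter value
  tick (G.arcs.length + n + q)
  let res ← parametricCut P G
  let arg ← (List.finRange q).foldlM (init := (none : Option (Fin q × ℝ))) fun acc l => do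
    -- four additions or subtractions for `z`, one comparison
    tick 5
    let z := rangeSum l + (res l).2.toReal
    return match acc with
      | none => some (l, z)
      | some (l', z') => if z < z' then some (l, z) else some (l', z')
  match arg with
  | none => return best
  | some (l, z) => do
    tick 1
    match best with
    | none =>
      -- copying the set
      tick n
      return some ((res l).1, z)
    | some (S, z') =>
      if z < z' then
        tick n
        return some ((res l).1, z)
      else
        return some (S, z')

/-- The node with (zero-based) index `k`. -/
abbrev Instance.node (I : Instance) (k : ℕ) (h : k < I.n) : Fin I.n := ⟨k, h⟩

/-- The first node. -/
def Instance.first (I : Instance) : Fin I.n := ⟨0, by have := I.two_le; omega⟩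

/-- The last node. -/
def Instance.last (I : Instance) : Fin I.n := ⟨I.n - 1, by have := I.two_le; omega⟩

/-- First loop, iteration `i`: the pairs `I₁ = [α_first, α_i]`, `I₂ = [α_j, α_last]` with
`first < j ≤ i + 1`. The nodes after `i` are shrunk into the sink, the nodes before `j` into the
source. The parameter value `l` stands for `j = l + 1`. -/
def firstLoopBody (I : Instance) (P : ParamCutProcedure) (best : Option (Finset (Fin I.n) × ℝ))
    (i : Fin (I.n - 1)) : Counted (Option (Finset (Fin I.n) × ℝ)) :=
  iteration P (q := i.val + 1)
    (shrink I I.first I.last (fun l v => v.val < l.val + 1) (fun v => i.val < v.val))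
    (fun l => (I.α (I.node i (by omega)) - I.α I.first) +
      (I.α I.last - I.α (I.node (l + 1) (by omega)))) best

/-- Second loop, iteration `i`: the pairs `I₁ = [α_first, α_last]`, `I₂ = [α_j, α_i]` with
`first < j ≤ i`. The node `i` is the sink, the nodes before `j` and after `i` are shrunk into the
source. The parameter value `l` stands for `j = l + 1`. -/
def secondLoopBody (I : Instance) (P : ParamCutProcedure) (best : Option (Finset (Fin I.n) × ℝ))
    (i : Fin (I.n - 1)) : Counted (Option (Finset (Fin I.n) × ℝ)) :=
  iteration P (q := i.val)
    (shrink I I.first (I.node i (by omega)) (fun l v => v.val < l.val + 1 ∨ i.val < v.val)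
      (fun _ => False))
    (fun l => (I.α I.last - I.α I.first) +
      (I.α (I.node i (by omega)) - I.α (I.node (l + 1) (by omega)))) best

/-- The Min Range Cut Algorithm. It returns a set `S*` and a value `z*` (`none` stands for the
initial `z* = ∞`). -/
def minRangeCutAlgorithm (I : Instance) (P : ParamCutProcedure) :
    Counted (Option (Finset (Fin I.n) × ℝ)) := do
  let best ← (List.finRange (I.n - 1)).foldlM (firstLoopBody I P) none
  ((List.finRange (I.n - 1)).filter fun i => 1 ≤ i.val).foldlM (secondLoopBody I P) best

/-! ### Real random access machine with a minimum `s,t`-cut procedure -/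

/-- A network with nonnegative capacities, source and sink. -/
structure STNetwork where
  nodes : ℕ
  arcs : List (Arc nodes ℝ≥0)
  source : Fin nodes
  sink : Fin nodes
  source_ne_sink : source ≠ sink

/-- A minimum `s,t`-cut procedure, as a function from networks to source sets. -/
def IsMinCutProcedure (O : (N : STNetwork) → Finset (Fin N.nodes)) : Prop :=
  ∀ N : STNetwork, IsMinSTCut N.arcs N.source N.sink (O N)

/-- The memory: arrays of natural numbers and arrays of real numbers, addressed by the name of
the array and an index. -/
structure Memory where
  nat : ℕ → ℕ → ℕ
  real : ℕ → ℕ → ℝ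

def Memory.setNat (σ : Memory) (a i x : ℕ) : Memory :=
  { σ with nat := Function.update σ.nat a (Function.update (σ.nat a) i x) }

def Memory.setReal (σ : Memory) (a i : ℕ) (x : ℝ) : Memory :=
  { σ with real := Function.update σ.real a (Function.update (σ.real a) i x) }

inductive NatExp where
  | lit (k : ℕ)
  | get (a : ℕ) (i : NatExp)
  | add (x y : NatExp)
  | sub (x y : NatExp)

def NatExp.eval (σ : Memory) : NatExp → ℕ
  | lit k => k
  | get a i => σ.nat a (i.eval σ)
  | add x y => x.eval σ + y.eval σ
  | sub x y => x.eval σ - y.eval σ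

inductive RealExp where
  | zero
  | one
  | get (a : ℕ) (i : NatExp)
  | add (x y : RealExp)
  | sub (x y : RealExp)

def RealExp.eval (σ : Memory) : RealExp → ℝ
  | zero => 0
  | one => 1
  | get a i => σ.real a (i.eval σ)
  | add x y => x.eval σ + y.eval σ
  | sub x y => x.eval σ - y.eval σ

inductive Test where
  | natLt (x y : NatExp)
  | realLt (x y : RealExp)

def Test.holds (σ : Memory) : Test → Prop
  | natLt x y => x.eval σ < y.eval σ
  | realLt x y => x.eval σ < y.eval σ

/-- Programs. `minCut N M s t tail head cap side` runs the minimum `s,t`-cut procedure on the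
network with `N` nodes and `M` arcs stored in the arrays `tail`, `head`, `cap`, and writes the
indicator of the source set to the array `side`. -/
inductive Program where
  | skip
  | setNat (a : ℕ) (i x : NatExp)
  | setReal (a : ℕ) (i : NatExp) (x : RealExp)
  | seq (p p' : Program)
  | ite (b : Test) (p p' : Program)
  | while (b : Test) (p : Program)
  | minCut (N M s t : NatExp) (tail head cap side : ℕ)

/-- The network `G` is stored at the given place of the memory. -/
structure STNetwork.StoredAt (G : STNetwork) (σ : Memory) (N M s t : NatExp)
    (tail head cap : ℕ) : Prop where
  nodes_eq : N.eval σ = G.nodes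
  arcs_eq : M.eval σ = G.arcs.length
  source_eq : s.eval σ = G.source
  sink_eq : t.eval σ = G.sink
  arc_eq : ∀ (k : ℕ) (h : k < G.arcs.length),
    σ.nat tail k = (G.arcs[k]).tail ∧ σ.nat head k = (G.arcs[k]).head ∧
      σ.real cap k = (G.arcs[k]).cap

open Classical in
/-- The memory after writing the indicator of `S` to the first `n` cells of the array `a`. -/
def Memory.writeSet (σ : Memory) (a : ℕ) {n : ℕ} (S : Finset (Fin n)) : Memory :=
  { σ with nat := Function.update σ.nat a fun k =>
      if h : k < n then (if (⟨k, h⟩ : Fin n) ∈ S then 1 else 0) else σ.nat a k }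

/-- `Exec O T p σ c σ'`: the program `p`, started in the memory `σ`, halts in `σ'` after `c`
steps. Assignments and tests are single steps (the expressions of a program have bounded size);
one call of the minimum `s,t`-cut procedure `O` on a network with `m` arcs and `n` nodes takes
`T m n` steps. -/
inductive Exec (O : (N : STNetwork) → Finset (Fin N.nodes)) (T : ℕ → ℕ → ℕ) :
    Program → Memory → ℕ → Memory → Prop where
  | skip (σ : Memory) : Exec O T .skip σ 1 σ
  | setNat (σ : Memory) (a : ℕ) (i x : NatExp) :
      Exec O T (.setNat a i x) σ 1 (σ.setNat a (i.eval σ) (x.eval σ))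
  | setReal (σ : Memory) (a : ℕ) (i : NatExp) (x : RealExp) :
      Exec O T (.setReal a i x) σ 1 (σ.setReal a (i.eval σ) (x.eval σ))
  | seq {p p' : Program} {σ σ' σ'' : Memory} {c c' : ℕ} :
      Exec O T p σ c σ' → Exec O T p' σ' c' σ'' → Exec O T (.seq p p') σ (c + c') σ''
  | iteTrue {b : Test} {p p' : Program} {σ σ' : Memory} {c : ℕ} :
      b.holds σ → Exec O T p σ c σ' → Exec O T (.ite b p p') σ (c + 1) σ'
  | iteFalse {b : Test} {p p' : Program} {σ σ' : Memory} {c : ℕ} :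
      ¬ b.holds σ → Exec O T p' σ c σ' → Exec O T (.ite b p p') σ (c + 1) σ'
  | whileTrue {b : Test} {p : Program} {σ σ' σ'' : Memory} {c c' : ℕ} :
      b.holds σ → Exec O T p σ c σ' → Exec O T (.while b p) σ' c' σ'' →
        Exec O T (.while b p) σ (c + c' + 1) σ''
  | whileFalse {b : Test} {p : Program} {σ : Memory} :
      ¬ b.holds σ → Exec O T (.while b p) σ 1 σ
  | minCut {σ : Memory} {N M s t : NatExp} {tail head cap side : ℕ} (G : STNetwork) :
      G.StoredAt σ N M s t tail head cap →
        Exec O T (.minCut N M s t tail head cap side) σ (T G.arcs.length G.nodes)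
          (σ.writeSet side (O G))

/-- The input: `n` and `m` in the array `0` of natural numbers, the endpoints of the edges in the
arrays `1` and `2` of natural numbers, the weights in the array `0` and the scalars in the array
`1` of real numbers; all other cells are zero. -/
def Instance.input (I : Instance) : Memory where
  nat a k :=
    if a = 0 then (if k = 0 then I.n else if k = 1 then I.m else 0)
    else if h : k < I.edges.length then
      (if a = 1 then (I.edges[k]).u else if a = 2 then (I.edges[k]).v else 0)
    else 0
  real a k :=
    if a = 0 then (if h : k < I.edges.length then (I.edges[k]).weight else 0)
    else if a = 1 then (if h : k < I.n then I.α ⟨k, h⟩ else 0)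
    else 0

/-- The output: the indicator of `S` in the array `3` of natural numbers, the value `z` in the
first cell of the array `2` of real numbers. -/
def Instance.IsOutput (I : Instance) (σ : Memory) (S : Finset (Fin I.n)) (z : ℝ) : Prop :=
  (∀ v : Fin I.n, (v ∈ S → σ.nat 3 v = 1) ∧ (v ∉ S → σ.nat 3 v = 0)) ∧ σ.real 2 0 = z

end RangeCut

end

/-! Both parts use that the objective is invariant under complement, so the first node may be
assumed to lie in `S`.

Part (a). If the last node is outside `S`, let `i` be the largest node of `S`; otherwise let `i` be
the largest node outside `S`. With `j` the smallest node outside `S`, the pair `(i, j)` fixes both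
ranges, and `S` is a finite cut of the network shrunk for that pair. Hence the value `z(j)` of the
pair is at most the objective of `S` (`Progress.firstLoopBody`, `Progress.secondLoopBody`).
Conversely, a minimum cut of a shrunk network has its clusters inside the two intervals, where they
may have smaller ranges, so its objective is at most `z(j)`. The final value thus lies between the
objective of the returned set and the optimum, and all three agree. The resource bounds are carried
along in the same loop invariant `Progress`.

Part (b) avoids parametric cuts. For each node `t` other than the first, one minimum cut finds the
best partition separating the first node from `t`, and the best of these `n - 1` partitions is
optimal. The ranges become cut capacities through three chains of `n` auxiliary nodes, which encode
the largest scalar of `S` and the largest and the smallest scalar of the complement; the smallest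
scalar of `S` is known. Minimizing over the auxiliary nodes yields the objective plus the constant
`width` (`objective_add_width_le`, `exists_cutCapacity_le`). The network has `4n` nodes and `2m +
9n` arcs, so each cut costs a constant multiple of `T m n`. What remains is to verify a concrete
program with its step count. -/

namespace RangeCut

/-! ### Ranges, complements and the objective -/

namespace Instance

variable (I : Instance)

theorem range_le {B : Finset (Fin I.n)} (hB : B.Nonempty) {lo hi : ℝ}
    (h : ∀ x ∈ B, lo ≤ I.α x ∧ I.α x ≤ hi) : I.range B ≤ hi - lo := by
  rw [range, dif_pos hB]
  have h1 : B.sup' hB I.α ≤ hi := Finset.sup'_le _ _ fun x hx => (h x hx).2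
  have h2 : lo ≤ B.inf' hB I.α := Finset.le_inf' _ _ fun x hx => (h x hx).1
  linarith

theorem sub_le_range {B : Finset (Fin I.n)} {x y : Fin I.n} (hx : x ∈ B) (hy : y ∈ B) :
    I.α x - I.α y ≤ I.range B := by
  rw [range, dif_pos ⟨x, hx⟩]
  have h1 := Finset.le_sup' I.α hx
  have h2 := Finset.inf'_le I.α hy
  linarith

theorem cut_compl (S : Finset (Fin I.n)) : I.cut Sᶜ = I.cut S := by
  unfold cut
  congr 1
  refine List.map_congr_left fun e _ => ?_
  congr 1
  simp only [Finset.mem_compl, not_not, eq_iff_iff]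
  tauto

theorem objective_compl (S : Finset (Fin I.n)) : I.objective Sᶜ = I.objective S := by
  unfold objective
  rw [cut_compl, compl_compl, add_comm (I.range Sᶜ)]

/-- Only an inequality, since the clusters need not reach the ends of their intervals. This is the
direction in which the value of an interval pair bounds a true objective. -/
theorem objective_le_of_bounds {S : Finset (Fin I.n)} (hS : S.Nonempty) (hS' : Sᶜ.Nonempty)
    {a b c d : ℝ} (h : ∀ x ∈ S, a ≤ I.α x ∧ I.α x ≤ b) (h' : ∀ x ∉ S, c ≤ I.α x ∧ I.α x ≤ d) :
    I.objective S ≤ (b - a) + (d - c) + I.cut S := by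
  unfold objective
  have h1 := I.range_le hS h
  have h2 := I.range_le hS' fun x hx => h' x (by simpa using hx)
  linarith

/-- Up to exchanging the two clusters, the first node lies in the first cluster. -/
theorem isMinRangeCut_of_first_mem {S : Finset (Fin I.n)} (hS : S.Nonempty) (hS' : Sᶜ.Nonempty)
    (h : ∀ S' : Finset (Fin I.n), I.first ∈ S' → S'ᶜ.Nonempty →
      I.objective S ≤ I.objective S') : I.IsMinRangeCut S := by
  refine ⟨hS, hS', fun S' h1 h2 => ?_⟩
  by_cases hf : I.first ∈ S'
  · exact h S' hf h2
  · rw [← I.objective_compl S']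
    exact h _ (by simpa using hf) (by simpa using h1)

end Instance

/-! ### Shrunk networks -/

theorem cutCapacity_append {n : ℕ} {R : Type} [AddCommMonoid R] (A B : List (Arc n R))
    (S : Finset (Fin n)) : cutCapacity (A ++ B) S = cutCapacity A S + cutCapacity B S := by
  simp [cutCapacity]

theorem cutCapacity_map {n : ℕ} {R β : Type} [AddCommMonoid R] (l : List β) (f : β → Arc n R)
    (S : Finset (Fin n)) : cutCapacity (l.map f) S =
      (l.map fun b => if (f b).tail ∈ S ∧ (f b).head ∉ S then (f b).cap else 0).sum := by
  simp [cutCapacity, Function.comp_def]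

/-- The arcs in both directions along the edges have the cut capacity of the undirected graph. -/
theorem Instance.cut_eq_sum_add_sum (I : Instance) (S : Finset (Fin I.n)) :
    I.cut S = (I.edges.map fun e => if e.u ∈ S ∧ e.v ∉ S then e.weight else 0).sum +
      (I.edges.map fun e => if e.v ∈ S ∧ e.u ∉ S then e.weight else 0).sum := by
  rw [← List.sum_map_add, Instance.cut]
  congr 1
  refine List.map_congr_left fun e _ => ?_
  by_cases h1 : e.u ∈ S <;> by_cases h2 : e.v ∈ S <;> simp [h1, h2]

theorem sum_map_ite_top {β : Type} (l : List β) (p : β → Prop) [DecidablePred p]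
    [Decidable (∃ b ∈ l, p b)] :
    (l.map fun b => if p b then (⊤ : ℝ≥0∞) else 0).sum = if ∃ b ∈ l, p b then ⊤ else 0 := by
  classical
  have H (l : List β) : (l.map fun b => if p b then (⊤ : ℝ≥0∞) else 0).sum =
      if ∃ b ∈ l, p b then ⊤ else 0 := by
    induction l with
    | nil => simp
    | cons a l ih => by_cases h : p a <;> simp [ih, h]
  rw [H]
  congr

/-- One violated shrinking puts an infinite arc into the cut, and `⊤` absorbs the rest of the sum.
If none is violated, only the edge arcs contribute, and each cut edge counts in exactly one of its
two directions. -/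
theorem cutCapacity_shrink (I : Instance) {q : ℕ} (s t : Fin I.n) (X : Fin q → Fin I.n → Prop)
    (Y : Fin I.n → Prop) (l : Fin q) {S : Finset (Fin I.n)} (hs : s ∈ S) (ht : t ∉ S) :
    ((∀ v, X l v → v ∈ S) ∧ (∀ v, Y v → v ∉ S) →
      cutCapacity ((shrink I s t X Y).arcsAt l) S = I.cut S) ∧
    (¬ ((∀ v, X l v → v ∈ S) ∧ (∀ v, Y v → v ∉ S)) →
      cutCapacity ((shrink I s t X Y).arcsAt l) S = ⊤) := by
  classical
  have hX : ((List.finRange I.n).map fun v =>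
      if s ∈ S ∧ v ∉ S then (if X l v then (⊤ : ℝ≥0∞) else 0) else 0).sum =
      if ∃ v ∈ List.finRange I.n, v ∉ S ∧ X l v then ⊤ else 0 := by
    rw [← sum_map_ite_top (List.finRange I.n) fun v => v ∉ S ∧ X l v]
    simp [hs, ite_and]
  have hY : ((List.finRange I.n).map fun v =>
      if v ∈ S ∧ t ∉ S then (if Y v then (⊤ : ℝ≥0∞) else 0) else 0).sum =
      if ∃ v ∈ List.finRange I.n, v ∈ S ∧ Y v then ⊤ else 0 := by
    rw [← sum_map_ite_top (List.finRange I.n) fun v => v ∈ S ∧ Y v]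
    simp [ht, ite_and]
  have hcoe (f : Edge I.n → ℝ≥0) :
      (((I.edges.map f).sum : ℝ≥0) : ℝ≥0∞) = (I.edges.map fun e => (f e : ℝ≥0∞)).sum := by
    have := map_list_sum ENNReal.ofNNRealHom (I.edges.map f)
    rwa [List.map_map] at this
  have key : cutCapacity ((shrink I s t X Y).arcsAt l) S = I.cut S +
      (if ∃ v ∈ List.finRange I.n, v ∉ S ∧ X l v then ⊤ else 0) +
      (if ∃ v ∈ List.finRange I.n, v ∈ S ∧ Y v then ⊤ else 0) := by
    rw [← hX, ← hY, I.cut_eq_sum_add_sum]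
    simp only [ParamNetwork.arcsAt, shrink, List.map_append, List.map_map, cutCapacity_append,
      cutCapacity_map, Function.comp_def, ENNReal.coe_add, hcoe, apply_ite ENNReal.ofNNReal,
      ENNReal.coe_zero]
  rw [key]
  simp only [List.mem_finRange, true_and]
  constructor
  · rintro ⟨h1, h2⟩
    rw [if_neg (by rintro ⟨v, hv, hv'⟩; exact hv (h1 v hv')),
      if_neg (by rintro ⟨v, hv, hv'⟩; exact h2 v hv' hv)]
    simp
  · intro h
    rw [not_and_or] at h
    push Not at h
    obtain ⟨v, hv, hv'⟩ | ⟨v, hv, hv'⟩ := h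
    · rw [if_pos ⟨v, hv', hv⟩]; simp
    · rw [if_pos (c := ∃ v, v ∈ S ∧ Y v) ⟨v, hv', hv⟩]; simp

/-- A minimum cut of a shrunk network obeys the shrinkings, if some cut does, and it minimizes the
cut capacity of the graph among all sets that obey them. -/
theorem IsMinSTCut.of_shrink {I : Instance} {q : ℕ} {s t : Fin I.n} {X : Fin q → Fin I.n → Prop}
    {Y : Fin I.n → Prop} {l : Fin q} {S S₀ : Finset (Fin I.n)}
    (h : IsMinSTCut ((shrink I s t X Y).arcsAt l) s t S) (hs : s ∈ S₀) (ht : t ∉ S₀)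
    (hX : ∀ v, X l v → v ∈ S₀) (hY : ∀ v, Y v → v ∉ S₀) :
    (∀ v, X l v → v ∈ S) ∧ (∀ v, Y v → v ∉ S) ∧
      cutCapacity ((shrink I s t X Y).arcsAt l) S = I.cut S ∧ I.cut S ≤ I.cut S₀ := by
  have h0 := (cutCapacity_shrink I s t X Y l hs ht).1 ⟨hX, hY⟩
  have hle := h.2.2 S₀ hs ht
  have h1 := cutCapacity_shrink I s t X Y l h.1 h.2.1
  by_cases hc : (∀ v, X l v → v ∈ S) ∧ (∀ v, Y v → v ∉ S)
  · refine ⟨hc.1, hc.2, h1.1 hc, ?_⟩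
    rw [h0, h1.1 hc] at hle
    exact_mod_cast hle
  · rw [h0, h1.2 hc] at hle
    simp at hle

/-- Growing shrinkings make the capacities of the source arcs nondecreasing. The arc from `s` to `t`
must have constant capacity, which is why the sink may never be shrunk into the source. -/
theorem shrink_isParametric (I : Instance) {q : ℕ} {s t : Fin I.n} {X : Fin q → Fin I.n → Prop}
    (Y : Fin I.n → Prop) (hst : s ≠ t) (hX : ∀ l l', l ≤ l' → ∀ v, X l v → X l' v)
    (ht : ∀ l, ¬ X l t) : (shrink I s t X Y).IsParametric := by
  classical
  refine ⟨hst, fun a ha => ?_⟩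
  simp only [shrink, List.mem_append, List.mem_map, List.mem_finRange, true_and] at ha
  obtain ((⟨e, -, rfl⟩ | ⟨e, -, rfl⟩) | ⟨v, rfl⟩) | ⟨v, rfl⟩ := ha
  · exact ⟨fun _ _ => monotone_const, fun _ _ => antitone_const, fun _ _ _ => rfl⟩
  · exact ⟨fun _ _ => monotone_const, fun _ _ => antitone_const, fun _ _ _ => rfl⟩
  · refine ⟨fun _ _ l l' hl => ?_, fun _ h => absurd rfl h, fun h l l' => ?_⟩
    · by_cases h : X l v
      · simp [h, hX l l' hl v h]
      · simp [h]
    · have hv : v = t := h.1 rfl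
      subst hv
      simp [ht]
  · exact ⟨fun _ _ => monotone_const, fun _ _ => antitone_const, fun _ _ _ => rfl⟩

theorem length_shrink_arcs (I : Instance) {q : ℕ} (s t : Fin I.n) (X : Fin q → Fin I.n → Prop)
    (Y : Fin I.n → Prop) : (shrink I s t X Y).arcs.length = 2 * (I.m + I.n) := by
  simp [shrink, Instance.m]; ring

/-! ### Loops that keep a ledger -/

/-- The invariant sees the prefix already processed, so it can record both what has been covered and
how many rounds have been paid for. -/
theorem foldlM_invariant {β γ τ : Type} (f : β → γ → StateM τ β) (Inv : List γ → β → τ → Prop)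
    (l : List γ) {b : β} {s : τ} (h0 : Inv [] b s)
    (hstep : ∀ pre a b s, a ∈ l → Inv pre b s →
      Inv (pre ++ [a]) ((f b a).run s).1 ((f b a).run s).2) :
    Inv l ((l.foldlM f b).run s).1 ((l.foldlM f b).run s).2 := by
  suffices H : ∀ (l' pre : List γ) (b : β) (s : τ), l' ⊆ l → Inv pre b s →
      Inv (pre ++ l') ((l'.foldlM f b).run s).1 ((l'.foldlM f b).run s).2 by
    simpa using H l [] b s (List.Subset.refl l) h0
  intro l'
  induction l' with
  | nil => intro pre b s _ h; rw [List.append_nil]; exact h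
  | cons a l' ih =>
    intro pre b s hl h
    have h1 := hstep pre a b s (hl (by simp)) h
    have h2 := ih (pre ++ [a]) _ _ (fun x hx => hl (by simp [hx])) h1
    rw [List.append_assoc] at h2
    exact h2

/-- An iteration makes one call; it replaces the incumbent only by a cut of that call, and leaves
an incumbent that is at most the old one and all the values of that call. -/
theorem iteration_spec (P : ParamCutProcedure) {n q : ℕ} (G : ParamNetwork n q)
    (rangeSum : Fin q → ℝ) (best : Option (Finset (Fin n) × ℝ)) (L : Ledger) :
    ∃ best' L', (iteration P G rangeSum best).run L = (best', L') ∧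
      L'.ownSteps ≤ L.ownSteps + (G.arcs.length + 2 * n + 6 * q + 1) ∧
      L'.callSteps = L.callSteps + P.time G ∧
      L'.calls = L.calls ++ [⟨n, G.arcs.length, q⟩] ∧
      (best' = best ∨ ∃ l, best' = some ((P.run G l).1, rangeSum l + (P.run G l).2.toReal)) ∧
      (∀ r ∈ best, ∃ r' ∈ best', r'.2 ≤ r.2) ∧
      ∀ l, ∃ r' ∈ best', r'.2 ≤ rangeSum l + (P.run G l).2.toReal := by
  classical
  set z : Fin q → ℝ := fun l => rangeSum l + (P.run G l).2.toReal with hz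
  set step : Option (Fin q × ℝ) → Fin q → Counted (Option (Fin q × ℝ)) := fun acc l => do
    tick 5
    let z := rangeSum l + (P.run G l).2.toReal
    return match acc with
      | none => some (l, z)
      | some (l', z') => if z < z' then some (l, z) else some (l', z') with hstep
  set L₁ : Ledger := ⟨L.ownSteps + (G.arcs.length + n + q), L.callSteps + P.time G,
    L.calls ++ [⟨n, G.arcs.length, q⟩]⟩ with hL₁
  -- The accumulator holds a parameter value with its `z`, minimal over the processed prefix; each
  -- round has cost five steps.
  have hfold := foldlM_invariant step (fun pre acc M =>
      M = { L₁ with ownSteps := L₁.ownSteps + 5 * pre.length } ∧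
      (∀ r ∈ acc, r.2 = z r.1) ∧ ∀ l ∈ pre, ∃ r ∈ acc, r.2 ≤ z l) (List.finRange q)
      (b := none) (s := L₁) (by simp) (by
    rintro pre a acc M - ⟨rfl, h1, h2⟩
    have hrun : (step acc a).run { L₁ with ownSteps := L₁.ownSteps + 5 * pre.length } =
        (match (generalizing := false) acc with
          | none => some (a, z a)
          | some (l', z') => if z a < z' then some (a, z a) else some (l', z'),
          { L₁ with ownSteps := L₁.ownSteps + 5 * pre.length + 5 }) := rfl
    rw [hrun]
    refine ⟨by simp; ring, ?_, ?_⟩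
    · rcases acc with _ | ⟨l', z'⟩
      · simp
      · by_cases h : z a < z'
        · simp [h]
        · simpa [h] using h1
    · intro l hl
      rcases acc with _ | ⟨l', z'⟩
      · rcases List.mem_append.1 hl with hl | hl
        · simpa using h2 l hl
        · simp_all
      · have h3 : l ∈ pre → z' ≤ z l := by simpa using h2 l
        by_cases h : z a < z'
        · rcases List.mem_append.1 hl with hl | hl
          · simpa [h] using h.le.trans (h3 hl)
          · simp_all
        · rcases List.mem_append.1 hl with hl | hl
          · simpa [h] using h3 hl
          · obtain rfl : l = a := by simpa using hl
            simpa [h] using not_lt.1 h)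
  have hrun : (iteration P G rangeSum best).run L =
      (match ((List.finRange q).foldlM step none).run L₁ with
        | (none, M) => (best, M)
        | (some (l, z), M) => match best with
          | none => (some ((P.run G l).1, z), { M with ownSteps := M.ownSteps + 1 + n })
          | some (S, z') => if z < z' then
              (some ((P.run G l).1, z), { M with ownSteps := M.ownSteps + 1 + n })
            else (some (S, z'), { M with ownSteps := M.ownSteps + 1 })) := by
    -- The continuation after the inner loop is isolated as a function of its result, so that this
    -- result can be generalized before the case distinction.
    let rest : Option (Fin q × ℝ) → Counted (Option (Finset (Fin n) × ℝ)) := fun arg =>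
      match arg with
      | none => pure best
      | some (l, z) => (tick 1).bind fun _ => match best with
        | none => (tick n).bind fun _ => pure (some ((P.run G l).1, z))
        | some (S, z') => if z < z' then (tick n).bind fun _ => pure (some ((P.run G l).1, z))
          else pure (some (S, z'))
    have h0 : (iteration P G rangeSum best).run L =
        (rest (((List.finRange q).foldlM step none).run L₁).1).run
          (((List.finRange q).foldlM step none).run L₁).2 := rfl
    rw [h0]
    generalize ((List.finRange q).foldlM step none).run L₁ = r
    rcases r with ⟨_ | ⟨l, z⟩, M⟩
    · rfl
    · rcases best with _ | ⟨S, z'⟩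
      · rfl
      · by_cases h : z < z'
        · simp only [rest, h, if_true]; rfl
        · simp only [rest, h, if_false]; rfl
  rw [hrun]
  rcases hM : ((List.finRange q).foldlM step none).run L₁ with ⟨acc, M⟩
  rw [hM] at hfold
  obtain ⟨hM', h1, h2⟩ := hfold
  simp only [List.length_finRange, List.mem_finRange, forall_const] at hM' h2
  rcases acc with _ | ⟨l, z₀⟩
  · refine ⟨_, _, rfl, ?_, ?_, ?_, Or.inl rfl, fun r hr => ⟨r, hr, le_rfl⟩, ?_⟩
    · simp [hM', hL₁]; omega
    · simp [hM', hL₁]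
    · simp [hM', hL₁]
    · intro l; simpa using h2 l
  · have hz₀ : z₀ = z l := by simpa using h1
    have h3 : ∀ l', z₀ ≤ z l' := by simpa using h2
    rcases best with _ | ⟨S, z'⟩
    · refine ⟨_, _, rfl, ?_, ?_, ?_, Or.inr ⟨l, by simp [hz₀, hz]⟩, by simp, ?_⟩
      · simp [hM', hL₁]; omega
      · simp [hM', hL₁]
      · simp [hM', hL₁]
      · simpa using h3
    · by_cases h : z₀ < z'
      · simp only [h, if_true]
        refine ⟨_, _, rfl, ?_, ?_, ?_, Or.inr ⟨l, by simp [hz₀, hz]⟩, ?_, ?_⟩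
        · simp [hM', hL₁]; omega
        · simp [hM', hL₁]
        · simp [hM', hL₁]
        · simpa using h.le
        · simpa using h3
      · simp only [h, if_false]
        refine ⟨_, _, rfl, ?_, ?_, ?_, Or.inl rfl, ?_, ?_⟩
        · simp [hM', hL₁]; omega
        · simp [hM', hL₁]
        · simp [hM', hL₁]
        · simp
        · simpa using fun l => (not_lt.1 h).trans (h3 l)

/-! ### Correctness and running time of the Min Range Cut Algorithm -/

/-- The state after calls with the numbers `vals` of parameter values: what has been spent, and
an incumbent that is valid and beats all sets in `Covered`. -/
structure Progress (I : Instance) (P : ParamCutProcedure) (Covered : Finset (Fin I.n) → Prop)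
    (vals : List ℕ) (best : Option (Finset (Fin I.n) × ℝ)) (L : Ledger) : Prop where
  ownSteps_le : L.ownSteps ≤ vals.length * (2 * (I.m + I.n) + 8 * I.n + 1)
  callSteps_le : ∀ x, (∀ (q : ℕ) (G : ParamNetwork I.n q), G.IsParametric → q ≤ I.n →
    G.arcs.length = 2 * (I.m + I.n) → P.time G ≤ x) → L.callSteps ≤ vals.length * x
  calls_eq : L.calls = vals.map fun q => ⟨I.n, 2 * (I.m + I.n), q⟩
  vals_le : ∀ q ∈ vals, q ≤ I.n
  valid : ∀ r ∈ best, r.1.Nonempty ∧ r.1ᶜ.Nonempty ∧ I.objective r.1 ≤ r.2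
  covered : ∀ S, Covered S → ∃ r ∈ best, r.2 ≤ I.objective S

/-- `hvalid` keeps the incumbent honest and `hcov` adds the newly covered sets. The time inside
calls is bounded for every uniform bound `x`, so that the cut time can be substituted at the end. -/
theorem Progress.iteration {I : Instance} {P : ParamCutProcedure}
    {Covered Covered' : Finset (Fin I.n) → Prop} {vals : List ℕ}
    {best : Option (Finset (Fin I.n) × ℝ)} {L : Ledger} (h : Progress I P Covered vals best L)
    {q : ℕ} (hq : q ≤ I.n) (G : ParamNetwork I.n q) (hG : G.IsParametric)
    (hlen : G.arcs.length = 2 * (I.m + I.n)) (rangeSum : Fin q → ℝ)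
    (hvalid : ∀ l, (P.run G l).1.Nonempty ∧ (P.run G l).1ᶜ.Nonempty ∧
      I.objective (P.run G l).1 ≤ rangeSum l + (P.run G l).2.toReal)
    (hcov : ∀ S, Covered' S → ∃ l, rangeSum l + (P.run G l).2.toReal ≤ I.objective S) :
    Progress I P (fun S => Covered S ∨ Covered' S) (vals ++ [q])
      ((RangeCut.iteration P G rangeSum best).run L).1
      ((RangeCut.iteration P G rangeSum best).run L).2 := by
  obtain ⟨best', L', hrun, h1, h2, h3, h4, h5, h6⟩ := iteration_spec P G rangeSum best L
  rw [hrun]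
  refine ⟨?_, fun x hx => ?_, ?_, ?_, ?_, ?_⟩
  -- By `q ≤ n`, the term `2n + 6q` of one iteration is at most `8n`.
  · have := h.ownSteps_le
    simp only [List.length_append, List.length_singleton]
    rw [add_mul, one_mul]
    rw [hlen] at h1
    omega
  · have h7 := h.callSteps_le x hx
    have h8 := hx q G hG hq hlen
    simp only [List.length_append, List.length_singleton]
    rw [add_mul, one_mul]
    omega
  · simp [h3, h.calls_eq, hlen]
  · intro q' hq'
    rcases List.mem_append.1 hq' with hq' | hq'
    · exact h.vals_le q' hq'
    · rw [List.mem_singleton.1 hq']; exact hq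
  · intro r hr
    obtain rfl | ⟨l, rfl⟩ := h4
    · exact h.valid r hr
    · obtain rfl : _ = r := by simpa using hr
      exact hvalid l
  · rintro S (hS | hS)
    · obtain ⟨r, hr, hr'⟩ := h.covered S hS
      obtain ⟨r', hr2, hr3⟩ := h5 r hr
      exact ⟨r', hr2, hr3.trans hr'⟩
    · obtain ⟨l, hl⟩ := hcov S hS
      obtain ⟨r', hr2, hr3⟩ := h6 l
      exact ⟨r', hr2, hr3.trans hl⟩

theorem Progress.congr {I : Instance} {P : ParamCutProcedure}
    {Covered Covered' : Finset (Fin I.n) → Prop} {vals : List ℕ}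
    {best : Option (Finset (Fin I.n) × ℝ)} {L : Ledger} (h : Progress I P Covered vals best L)
    (hc : ∀ S, Covered' S → Covered S) : Progress I P Covered' vals best L :=
  ⟨h.1, h.2, h.3, h.4, h.5, fun S hS => h.6 S (hc S hS)⟩

/-- The sets with first node `0` and last node `i`. -/
def LastMem (I : Instance) (i : Fin (I.n - 1)) (S : Finset (Fin I.n)) : Prop :=
  I.first ∈ S ∧ (⟨i, by omega⟩ : Fin I.n) ∈ S ∧ ∀ v : Fin I.n, i.val < v.val → v ∉ S

/-- The sets with first node `0` whose complement has last node `i`. -/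
def LastNotMem (I : Instance) (i : Fin (I.n - 1)) (S : Finset (Fin I.n)) : Prop :=
  I.first ∈ S ∧ (⟨i, by omega⟩ : Fin I.n) ∉ S ∧ ∀ v : Fin I.n, i.val < v.val → v ∈ S

/-! ### Extreme nodes of a partition, and the coverage of all partitions by the two loops -/

namespace Instance

variable (I : Instance)

theorem first_le (v : Fin I.n) : I.α I.first ≤ I.α v :=
  I.strictMono.monotone (Fin.mk_le_of_le_val (Nat.zero_le _))

theorem le_last (v : Fin I.n) : I.α v ≤ I.α I.last :=
  I.strictMono.monotone (Fin.le_def.2 (by simp only [last]; omega))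

theorem exists_min_notMem {S : Finset (Fin I.n)} (h : Sᶜ.Nonempty) (hf : I.first ∈ S) :
    ∃ j : Fin I.n, j ∉ S ∧ 1 ≤ j.val ∧ ∀ v : Fin I.n, v.val < j.val → v ∈ S := by
  have hmem := Sᶜ.min'_mem h
  refine ⟨Sᶜ.min' h, by simpa using hmem, ?_, fun v hv => ?_⟩
  · by_contra hc
    have : Sᶜ.min' h = I.first := Fin.ext (by simp only [first]; omega)
    rw [this] at hmem
    simp [hf] at hmem
  · by_contra hc
    have := Finset.min'_le Sᶜ v (by simpa using hc)
    exact absurd (Fin.le_def.1 this) (by omega)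

/-- The cluster of the last node decides which loop treats the partition. The largest node of the
other cluster is then not the last one, hence a valid loop index. -/
theorem lastMem_or_lastNotMem {S : Finset (Fin I.n)} (hf : I.first ∈ S) (h : Sᶜ.Nonempty) :
    ∃ i : Fin (I.n - 1), LastMem I i S ∨ (1 ≤ i.val ∧ LastNotMem I i S) := by
  set M := S.max' ⟨_, hf⟩ with hM
  have hMS : M ∈ S := S.max'_mem _
  have hMle : ∀ v ∈ S, v.val ≤ M.val := fun v hv => Fin.le_def.1 (S.le_max' v hv)
  by_cases hlt : M.val < I.n - 1
  · refine ⟨⟨M.val, hlt⟩, Or.inl ⟨hf, hMS, fun v hv hvS => ?_⟩⟩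
    have := hMle v hvS
    simp only at hv
    omega
  · set N := Sᶜ.max' h with hN
    have hNS : N ∉ S := by simpa using Sᶜ.max'_mem h
    have hNle : ∀ v ∉ S, v.val ≤ N.val :=
      fun v hv => Fin.le_def.1 (Sᶜ.le_max' v (by simpa using hv))
    have h1 : N.val ≠ M.val := fun hc => hNS (Fin.ext hc ▸ hMS)
    have h2 : N.val ≠ 0 := fun hc => hNS ((Fin.ext hc : N = I.first) ▸ hf)
    have hN := N.isLt
    have hM := M.isLt
    refine ⟨⟨N.val, by omega⟩, Or.inr ⟨by simp only; omega, hf, hNS, fun v hv => ?_⟩⟩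
    by_contra hvS
    have := hNle v hvS
    simp only at hv
    omega

end Instance

/-- The test set `S₀` has two uses: its finite capacity forces the minimum cut to obey the
shrinkings, and it is a competitor. The first use needs just some admissible set, the second the
partition to be beaten. -/
theorem ParamCutProcedure.Correct.run_shrink {P : ParamCutProcedure} (hP : P.Correct) {I : Instance}
    {q : ℕ} {s t : Fin I.n} {X : Fin q → Fin I.n → Prop} {Y : Fin I.n → Prop}
    (hG : (shrink I s t X Y).IsParametric) (l : Fin q) {S₀ : Finset (Fin I.n)} (hs : s ∈ S₀)
    (ht : t ∉ S₀) (hX : ∀ v, X l v → v ∈ S₀) (hY : ∀ v, Y v → v ∉ S₀) :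
    s ∈ (P.run (shrink I s t X Y) l).1 ∧ t ∉ (P.run (shrink I s t X Y) l).1 ∧
    (∀ v, X l v → v ∈ (P.run (shrink I s t X Y) l).1) ∧
    (∀ v, Y v → v ∉ (P.run (shrink I s t X Y) l).1) ∧
    (P.run (shrink I s t X Y) l).2.toReal = I.cut (P.run (shrink I s t X Y) l).1 ∧
    (P.run (shrink I s t X Y) l).2.toReal ≤ I.cut S₀ := by
  obtain ⟨h1, h2⟩ := hP _ hG l
  obtain ⟨h3, h4, h5, h6⟩ := IsMinSTCut.of_shrink h1 hs ht hX hY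
  have h7 : (P.run (shrink I s t X Y) l).2.toReal = I.cut (P.run (shrink I s t X Y) l).1 := by
    rw [h2, h5]; simp
  refine ⟨h1.1, h1.2.1, h3, h4, h7, ?_⟩
  rw [h7]
  exact_mod_cast h6

theorem Progress.firstLoopBody {I : Instance} {P : ParamCutProcedure} (hP : P.Correct)
    {Covered : Finset (Fin I.n) → Prop} {vals : List ℕ}
    {best : Option (Finset (Fin I.n) × ℝ)} {L : Ledger} (h : Progress I P Covered vals best L)
    (i : Fin (I.n - 1)) :
    Progress I P (fun S => Covered S ∨ LastMem I i S) (vals ++ [i.val + 1])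
      ((RangeCut.firstLoopBody I P best i).run L).1
      ((RangeCut.firstLoopBody I P best i).run L).2 := by
  have hn := I.two_le
  have hi := i.isLt
  have hlast : I.last.val = I.n - 1 := rfl
  have hfirst : I.first.val = 0 := rfl
  have hG : (shrink I (q := i.val + 1) I.first I.last (fun l v => v.val < l.val + 1)
      (fun v => i.val < v.val)).IsParametric := by
    refine shrink_isParametric I _ ?_ ?_ ?_
    · intro hc; have := congrArg Fin.val hc; omega
    · intro l l' hl v hv; have := Fin.le_def.1 hl; omega
    · intro l; omega
  refine h.iteration (by omega) _ hG (length_shrink_arcs ..) _ (fun l => ?_) (fun S hS => ?_)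
  -- The nodes before `j` form an admissible cut, because `j ≤ i + 1` keeps them away from the nodes
  -- shrunk into the sink.
  · obtain ⟨h1, h2, h3, h4, h5, -⟩ := hP.run_shrink hG l
      (S₀ := Finset.univ.filter fun v => v.val < l.val + 1) (by simp [hfirst])
      (by simp; omega) (by simp) (by simp; omega)
    refine ⟨⟨_, h1⟩, ⟨_, by simpa using h2⟩, ?_⟩
    rw [h5]
    refine I.objective_le_of_bounds ⟨_, h1⟩ ⟨_, by simpa using h2⟩
      (fun x hx => ⟨I.first_le x, I.strictMono.monotone (Fin.le_def.2 ?_)⟩)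
      (fun x hx => ⟨I.strictMono.monotone (Fin.le_def.2 ?_), I.le_last x⟩)
    · by_contra hc
      exact h4 x (not_le.1 hc) hx
    · by_contra hc
      exact hx (h3 x (not_le.1 hc))
  · obtain ⟨hf, hiS, hgt⟩ := hS
    have hlS : I.last ∉ S := hgt _ (by omega)
    obtain ⟨j, hj, hj1, hjlt⟩ := I.exists_min_notMem ⟨_, by simpa using hlS⟩ hf
    -- The node `i + 1` exists and lies outside `S`, so the smallest node outside `S` is within the
    -- range of the parameter; it corresponds to `l = j - 1`.
    have hji : j.val ≤ i.val + 1 := by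
      by_contra hc
      exact hgt ⟨i.val + 1, by omega⟩ (by simp) (hjlt _ (by simp only; omega))
    refine ⟨⟨j.val - 1, by omega⟩, ?_⟩
    obtain ⟨-, -, -, -, -, h6⟩ := hP.run_shrink hG ⟨j.val - 1, by omega⟩ (S₀ := S) hf hlS
      (fun v hv => hjlt v (by simp only at hv; omega)) hgt
    have h7 := I.sub_le_range hiS hf
    have h8 := I.sub_le_range (B := Sᶜ) (x := I.last) (y := j) (by simpa using hlS)
      (by simpa using hj)
    have h9 : I.node (j.val - 1 + 1) (by omega) = j := Fin.ext (by simp only; omega)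
    simp only [h9]
    unfold Instance.objective
    simp only [Instance.node] at *
    linarith

theorem Progress.secondLoopBody {I : Instance} {P : ParamCutProcedure} (hP : P.Correct)
    {Covered : Finset (Fin I.n) → Prop} {vals : List ℕ}
    {best : Option (Finset (Fin I.n) × ℝ)} {L : Ledger} (h : Progress I P Covered vals best L)
    (i : Fin (I.n - 1)) (hi1 : 1 ≤ i.val) :
    Progress I P (fun S => Covered S ∨ LastNotMem I i S) (vals ++ [i.val])
      ((RangeCut.secondLoopBody I P best i).run L).1
      ((RangeCut.secondLoopBody I P best i).run L).2 := by
  have hn := I.two_le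
  have hi := i.isLt
  have hlast : I.last.val = I.n - 1 := rfl
  have hfirst : I.first.val = 0 := rfl
  have hG : (shrink I (q := i.val) I.first (I.node i (by omega))
      (fun l v => v.val < l.val + 1 ∨ i.val < v.val) (fun _ => False)).IsParametric := by
    refine shrink_isParametric I _ ?_ ?_ ?_
    · intro hc; have := congrArg Fin.val hc; simp only at this; omega
    · intro l l' hl v hv; have := Fin.le_def.1 hl; omega
    · intro l; simp only; omega
  refine h.iteration (by omega) _ hG (length_shrink_arcs ..) _ (fun l => ?_) (fun S hS => ?_)
  -- Here the admissible cut consists of everything outside the interval from `j` to `i`.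
  · obtain ⟨h1, h2, h3, h4, h5, -⟩ := hP.run_shrink hG l
      (S₀ := Finset.univ.filter fun v => v.val < l.val + 1 ∨ i.val < v.val) (by simp [hfirst])
      (by simp) (by simp) (by simp)
    refine ⟨⟨_, h1⟩, ⟨_, by simpa using h2⟩, ?_⟩
    rw [h5]
    refine I.objective_le_of_bounds ⟨_, h1⟩ ⟨_, by simpa using h2⟩
      (fun x hx => ⟨I.first_le x, I.le_last x⟩)
      (fun x hx => ⟨I.strictMono.monotone (Fin.le_def.2 ?_),
        I.strictMono.monotone (Fin.le_def.2 ?_)⟩)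
    · by_contra hc
      exact hx (h3 x (Or.inl (not_le.1 hc)))
    · by_contra hc
      exact hx (h3 x (Or.inr (not_le.1 hc)))
  · obtain ⟨hf, hiS, hgt⟩ := hS
    have hlS : I.last ∈ S := hgt _ (by omega)
    obtain ⟨j, hj, hj1, hjlt⟩ := I.exists_min_notMem ⟨_, by simpa using hiS⟩ hf
    have hji : j.val ≤ i.val := by
      by_contra hc
      exact hiS (hjlt _ (by simp only; omega))
    refine ⟨⟨j.val - 1, by omega⟩, ?_⟩
    obtain ⟨-, -, -, -, -, h6⟩ := hP.run_shrink hG ⟨j.val - 1, by omega⟩ (S₀ := S) hf hiS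
      (fun v hv => hv.elim (fun hv => hjlt v (by simp only at hv; omega)) (hgt v)) (by simp)
    have h7 := I.sub_le_range hlS hf
    have h8 := I.sub_le_range (B := Sᶜ) (y := j) (by simpa using hiS) (by simpa using hj)
    have h9 : I.node (j.val - 1 + 1) (by omega) = j := Fin.ext (by simp only; omega)
    simp only [h9]
    unfold Instance.objective
    simp only [Instance.node] at *
    linarith

theorem progress_minRangeCutAlgorithm (I : Instance) {P : ParamCutProcedure} (hP : P.Correct) :
    Progress I P (fun S => I.first ∈ S ∧ Sᶜ.Nonempty)
      ((List.finRange (I.n - 1)).map (fun i => i.val + 1) ++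
        ((List.finRange (I.n - 1)).filter fun i => 1 ≤ i.val).map (fun i => i.val))
      ((minRangeCutAlgorithm I P).run Ledger.empty).1
      ((minRangeCutAlgorithm I P).run Ledger.empty).2 := by
  have h1 := foldlM_invariant (firstLoopBody I P) (fun pre best L =>
      Progress I P (fun S => ∃ i ∈ pre, LastMem I i S) (pre.map fun i => i.val + 1) best L)
    (List.finRange (I.n - 1)) (b := none) (s := Ledger.empty)
    ⟨by simp [Ledger.empty], by simp [Ledger.empty], by simp [Ledger.empty], by simp, by simp,
      by simp⟩ (by
    intro pre i best L _ h
    rw [List.map_append]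
    refine (h.firstLoopBody hP i).congr ?_
    rintro S ⟨j, hj, hS⟩
    rcases List.mem_append.1 hj with hj | hj
    · exact Or.inl ⟨j, hj, hS⟩
    · obtain rfl := List.mem_singleton.1 hj
      exact Or.inr hS)
  set r := ((List.finRange (I.n - 1)).foldlM (firstLoopBody I P) none).run Ledger.empty
  have h2 := foldlM_invariant (secondLoopBody I P) (fun pre best L =>
      Progress I P (fun S => (∃ i ∈ List.finRange (I.n - 1), LastMem I i S) ∨
          ∃ i ∈ pre, LastNotMem I i S)
        ((List.finRange (I.n - 1)).map (fun i => i.val + 1) ++ pre.map fun i => i.val) best L)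
    ((List.finRange (I.n - 1)).filter fun i => 1 ≤ i.val) (b := r.1) (s := r.2)
    (by simpa using h1) (by
    intro pre i best L hi h
    rw [List.map_append, ← List.append_assoc]
    refine (h.secondLoopBody hP i (by simpa using hi)).congr ?_
    rintro S (hS | ⟨j, hj, hS⟩)
    · exact Or.inl (Or.inl hS)
    · rcases List.mem_append.1 hj with hj | hj
      · exact Or.inl (Or.inr ⟨j, hj, hS⟩)
      · obtain rfl := List.mem_singleton.1 hj
        exact Or.inr hS)
  refine Progress.congr h2 ?_
  rintro S ⟨hf, hS⟩
  obtain ⟨i, hi | ⟨hi, hi'⟩⟩ := I.lastMem_or_lastNotMem hf hS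
  · exact Or.inl ⟨i, by simp, hi⟩
  · exact Or.inr ⟨i, by simpa using hi, hi'⟩

/-- For each `i` the two loops use `i + 1` and `i` parameter values, together `2i + 1`, and the
first `k` odd numbers sum to `k ^ 2`. The filter drops only a zero. -/
theorem sum_loop_values_le (k : ℕ) :
    ((List.finRange k).map (fun i : Fin k => i.val + 1) ++
      ((List.finRange k).filter fun i : Fin k => 1 ≤ i.val).map (fun i : Fin k => i.val)).sum ≤ k ^ 2 := by
  have h1 : (((List.finRange k).filter fun i : Fin k => 1 ≤ i.val).map (fun i : Fin k => i.val)).sum ≤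
      ((List.finRange k).map fun i : Fin k => i.val).sum :=
    (List.Sublist.map _ List.filter_sublist).sum_le_sum (by simp)
  have h2 : ((List.finRange k).map fun i : Fin k => i.val + 1).sum +
      ((List.finRange k).map fun i : Fin k => i.val).sum = k ^ 2 := by
    rw [← Fin.sum_univ_def, ← Fin.sum_univ_def, Fin.sum_univ_eq_sum_range (fun i => i + 1),
      Fin.sum_univ_eq_sum_range (fun i => i)]
    clear h1
    induction k with
    | zero => simp
    | succ k ih =>
      rw [Finset.sum_range_succ, Finset.sum_range_succ]
      linarith [ih]
  rw [List.sum_append]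
  omega

theorem IsCutTime.two_mul_le {T : ℕ → ℕ → ℕ} {D : ℕ} (hT : IsCutTime T D) (m n : ℕ) :
    T (2 * (m + n)) n ≤ D * T m n :=
  (hT.mono _ _ _ _ le_rfl (by omega)).trans (hT.growth m n)

theorem minRangeCutAlgorithm_spec :
    ∃ C₀ : ℕ, ∀ D K : ℕ, ∃ C : ℕ,
      ∀ (P : ParamCutProcedure), P.Correct → ∀ I : Instance,
        ∃ (S : Finset (Fin I.n)) (z : ℝ) (L : Ledger),
          (minRangeCutAlgorithm I P).run Ledger.empty = (some (S, z), L) ∧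
          I.IsMinRangeCut S ∧ z = I.objective S ∧
          L.calls.length ≤ 2 * I.n ∧
          (L.calls.map CallSize.values).sum ≤ I.n ^ 2 ∧
          (∀ c ∈ L.calls, c.nodes = I.n ∧ c.arcs ≤ 2 * (I.m + I.n) ∧ c.values ≤ I.n) ∧
          L.ownSteps ≤ C₀ * (I.n * (I.m + I.n)) ∧
          ∀ T : ℕ → ℕ → ℕ, IsCutTime T D →
            (∀ (n q : ℕ) (G : ParamNetwork n q), G.IsParametric → q ≤ n →
              P.time G ≤ K * T G.arcs.length n) →
            L.steps ≤ C * (I.n * T I.m I.n) := by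
  -- There are at most `2n` iterations. Each costs at most `11(m + n)` own steps, and at most `K * D
  -- * T m n` inside its call.
  refine ⟨22, fun D K => ⟨22 + 2 * (K * D), fun P hP I => ?_⟩⟩
  have hn := I.two_le
  have h := progress_minRangeCutAlgorithm I hP
  set vals := (List.finRange (I.n - 1)).map (fun i => i.val + 1) ++
        ((List.finRange (I.n - 1)).filter fun i => 1 ≤ i.val).map (fun i => i.val) with hvals
  rcases hrun : (minRangeCutAlgorithm I P).run Ledger.empty with ⟨best, L⟩
  rw [hrun] at h
  simp only at h
  have hlen : vals.length ≤ 2 * I.n := by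
    have := List.length_filter_le (fun i : Fin (I.n - 1) => decide (1 ≤ i.val))
      (List.finRange (I.n - 1))
    simp only [hvals, List.length_append, List.length_map, List.length_finRange] at this ⊢
    omega
  have hfirst : ({I.first} : Finset (Fin I.n))ᶜ.Nonempty :=
    ⟨I.last, by
      simp only [Finset.mem_compl, Finset.mem_singleton]
      intro hc
      have := congrArg Fin.val hc
      simp only [Instance.first, Instance.last] at this
      omega⟩
  -- The partition that splits off the first node is covered, so the incumbent cannot still be
  -- `none`.
  obtain ⟨⟨S, z⟩, hr, -⟩ := h.covered {I.first} ⟨by simp, hfirst⟩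
  obtain rfl : best = some (S, z) := hr
  obtain ⟨hS, hS', hSz⟩ := h.valid (S, z) rfl
  have hz : ∀ S' : Finset (Fin I.n), I.first ∈ S' → S'ᶜ.Nonempty → z ≤ I.objective S' := by
    intro S' h1 h2
    simpa using h.covered S' ⟨h1, h2⟩
  have hopt := I.isMinRangeCut_of_first_mem hS hS' fun S' h1 h2 => hSz.trans (hz S' h1 h2)
  have hown : L.ownSteps ≤ 22 * (I.n * (I.m + I.n)) := by
    refine h.ownSteps_le.trans ((Nat.mul_le_mul hlen (?_ : _ ≤ 11 * (I.m + I.n))).trans ?_)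
    · omega
    · apply le_of_eq; ring
  refine ⟨S, z, L, rfl, hopt, ?_, ?_, ?_, ?_, hown, ?_⟩
  -- Validity gives one inequality; the other holds because the returned partition is itself
  -- covered, after a complement if necessary.
  · refine le_antisymm ?_ hSz
    by_cases hf : I.first ∈ S
    · exact hz S hf hS'
    · rw [← I.objective_compl]
      exact hz _ (by simpa using hf) (by simpa using hS)
  · simpa [h.calls_eq] using hlen
  · have h1 := sum_loop_values_le (I.n - 1)
    rw [h.calls_eq]
    simp only [List.map_map, Function.comp_def, List.map_id']
    exact h1.trans (Nat.pow_le_pow_left (by omega) 2)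
  · intro c hc
    rw [h.calls_eq] at hc
    obtain ⟨q, hq, rfl⟩ := List.mem_map.1 hc
    exact ⟨rfl, le_rfl, h.vals_le q hq⟩
  · intro T hT hK
    have h1 : L.callSteps ≤ vals.length * (K * (D * T I.m I.n)) := by
      refine h.callSteps_le _ fun q G hG hq hlen => (hK _ _ G hG hq).trans ?_
      rw [hlen]
      exact Nat.mul_le_mul_left K (hT.two_mul_le _ _)
    have h2 : L.callSteps ≤ 2 * (K * D) * (I.n * T I.m I.n) :=
      (h1.trans (Nat.mul_le_mul_right _ hlen)).trans (le_of_eq (by ring))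
    have h3 : 22 * (I.n * (I.m + I.n)) ≤ 22 * (I.n * T I.m I.n) :=
      Nat.mul_le_mul_left _ (Nat.mul_le_mul_left _ (hT.size_le _ _))
    rw [Ledger.steps, add_mul]
    omega

/-! ### Chains: the largest scalar of a set as a cut -/

open Classical in
/-- The part of a cut paid in a chain `y` over the nodes `v`: an amount `R` for each `k` where
`v k` does not force `y k` or `y k` does not force `y (k - 1)`, and the increments of `a` over
`y`. -/
noncomputable def chainCost (n : ℕ) (R : ℝ) (a : ℕ → ℝ) (v y : ℕ → Prop) : ℝ :=
  ∑ k ∈ Finset.range n, ((if v k ∧ ¬ y k then R else 0) + (if y k ∧ ¬ y (k - 1) then R else 0) +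
    (if y k then a k - a (k - 1) else 0))

section Chain

variable {n : ℕ} {R : ℝ} {a : ℕ → ℝ} {v y : ℕ → Prop}

/-- A finite capacity `R` can replace infinity: breaking a forcing arc costs `R`, which is already
at least any increment `a M - a 0`. If no forcing arc is broken below `M`, the increments telescope.
-/
theorem le_chainCost (ha : ∀ k < n, a (k - 1) ≤ a k) (hR : ∀ k < n, a k - a 0 ≤ R) {M : ℕ}
    (hM : M < n) (hv : v M) : a M - a 0 ≤ chainCost n R a v y := by
  classical
  have hR0 : 0 ≤ R := by simpa using hR 0 (by omega)
  have hterm : ∀ k < n, 0 ≤ (if v k ∧ ¬ y k then R else 0) ∧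
      0 ≤ (if y k ∧ ¬ y (k - 1) then R else 0) ∧ 0 ≤ (if y k then a k - a (k - 1) else 0) := by
    intro k hk
    have := ha k hk
    refine ⟨?_, ?_, ?_⟩ <;> split_ifs <;> linarith
  have hprefix : ∀ j < n, y j → a j - a 0 ≤ ∑ k ∈ Finset.range (j + 1),
      ((if v k ∧ ¬ y k then R else 0) + (if y k ∧ ¬ y (k - 1) then R else 0) +
        (if y k then a k - a (k - 1) else 0)) := by
    intro j
    induction j with
    | zero =>
      intro h0 _
      obtain ⟨h1, h2, h3⟩ := hterm 0 h0
      rw [Finset.sum_range_one]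
      linarith
    | succ j ih =>
      intro hj hy
      rw [Finset.sum_range_succ]
      obtain ⟨h1, h2, h3⟩ := hterm (j + 1) hj
      by_cases hyj : y j
      · have := ih (by omega) hyj
        rw [if_pos hy] at h3 ⊢
        simp only [Nat.add_sub_cancel] at *
        linarith
      -- The chain is broken between `j` and `j + 1`, so one payment of `R` there suffices.
      · have hsum : 0 ≤ ∑ k ∈ Finset.range (j + 1),
            ((if v k ∧ ¬ y k then R else 0) + (if y k ∧ ¬ y (k - 1) then R else 0) +
              (if y k then a k - a (k - 1) else 0)) := by
          refine Finset.sum_nonneg fun k hk => ?_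
          obtain ⟨h1, h2, h3⟩ := hterm k (by have := Finset.mem_range.1 hk; omega)
          linarith
        have h4 := hR (j + 1) hj
        rw [if_pos (c := y (j + 1) ∧ ¬ y (j + 1 - 1)) ⟨hy, by simpa using hyj⟩]
        linarith
  by_cases hy : y M
  · refine (hprefix M hM hy).trans (Finset.sum_le_sum_of_subset_of_nonneg ?_ fun k hk _ => ?_)
    · intro k hk
      simp only [Finset.mem_range] at *
      omega
    · obtain ⟨h1, h2, h3⟩ := hterm k (Finset.mem_range.1 hk)
      linarith
  · refine (hR M hM).trans (le_trans ?_ (Finset.single_le_sum (fun k hk => ?_)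
      (Finset.mem_range.2 hM)))
    · obtain ⟨h1, h2, h3⟩ := hterm M hM
      rw [if_pos ⟨hv, hy⟩]
      linarith
    · obtain ⟨h1, h2, h3⟩ := hterm k (Finset.mem_range.1 hk)
      linarith

/-- An initial segment containing `v` breaks no forcing arc, and its increments telescope. At `k =
0` truncated subtraction makes the increment zero. -/
theorem chainCost_le_eq {M : ℕ} (hM : M < n) (hv : ∀ k < n, v k → k ≤ M) :
    chainCost n R a v (fun k => k ≤ M) = a M - a 0 := by
  classical
  have h1 : chainCost n R a v (fun k => k ≤ M) =
      ∑ k ∈ Finset.range n, if k ≤ M then a k - a (k - 1) else 0 := by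
    refine Finset.sum_congr rfl fun k hk => ?_
    have := hv k (Finset.mem_range.1 hk)
    rw [if_neg (by tauto), if_neg (by omega)]
    simp
  have h2 : (Finset.range n).filter (· ≤ M) = Finset.range (M + 1) := by
    ext k; simp only [Finset.mem_filter, Finset.mem_range]; omega
  rw [h1, ← Finset.sum_filter, h2]
  clear h1 h2 hv hM
  induction M with
  | zero => simp
  | succ M ih => rw [Finset.sum_range_succ, ih]; simp

end Chain

/-! ### The range network -/

/-- The scalars, indexed by natural numbers. -/
noncomputable def Instance.scalar (I : Instance) (k : ℕ) : ℝ := if h : k < I.n then I.α ⟨k, h⟩ else 0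

/-- The difference of the largest and the smallest scalar. -/
noncomputable def Instance.width (I : Instance) : ℝ := I.scalar (I.n - 1) - I.scalar 0

namespace Instance

variable (I : Instance)

theorem scalar_val (k : Fin I.n) : I.scalar k = I.α k := by simp [scalar]

theorem scalar_mono {j k : ℕ} (hjk : j ≤ k) (hk : k < I.n) : I.scalar j ≤ I.scalar k := by
  rw [scalar, scalar, dif_pos hk, dif_pos (by omega)]
  exact I.strictMono.monotone (Fin.mk_le_mk.2 hjk)

theorem width_nonneg : 0 ≤ I.width :=
  sub_nonneg.2 (I.scalar_mono (Nat.zero_le _) (by have := I.two_le; omega))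

/-- The two arcs along an edge. -/
def edgeArcs (e : Edge I.n) : List (Arc (4 * I.n) ℝ≥0) :=
  [⟨⟨e.u, by omega⟩, ⟨e.v, by omega⟩, e.weight⟩, ⟨⟨e.v, by omega⟩, ⟨e.u, by omega⟩, e.weight⟩]

/-- The arcs at position `k` of the three chains, which stand for the largest scalar of the source
set, the largest scalar and the smallest scalar of its complement. -/
noncomputable def chainArcs (t : Fin I.n) (k : Fin I.n) : List (Arc (4 * I.n) ℝ≥0) :=
  [⟨⟨k, by omega⟩, ⟨I.n + k, by omega⟩, I.width.toNNReal⟩,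
   ⟨⟨I.n + k, by omega⟩, ⟨I.n + (k - 1), by omega⟩, I.width.toNNReal⟩,
   ⟨⟨I.n + k, by omega⟩, ⟨t, by omega⟩, (I.scalar k - I.scalar (k - 1)).toNNReal⟩,
   ⟨⟨2 * I.n + k, by omega⟩, ⟨k, by omega⟩, I.width.toNNReal⟩,
   ⟨⟨2 * I.n + (k - 1), by omega⟩, ⟨2 * I.n + k, by omega⟩, I.width.toNNReal⟩,
   ⟨⟨0, by have := k.isLt; omega⟩, ⟨2 * I.n + k, by omega⟩, (I.scalar k - I.scalar (k - 1)).toNNReal⟩,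
   ⟨⟨3 * I.n + k, by omega⟩, ⟨I.n - 1 - k, by omega⟩, I.width.toNNReal⟩,
   ⟨⟨3 * I.n + (k - 1), by omega⟩, ⟨3 * I.n + k, by omega⟩, I.width.toNNReal⟩,
   ⟨⟨0, by have := k.isLt; omega⟩, ⟨3 * I.n + k, by omega⟩,
    (I.scalar (I.n - 1 - (k - 1)) - I.scalar (I.n - 1 - k)).toNNReal⟩]

/-- A network whose cuts separate `0` and `t`, and whose minimum cut minimizes the objective. -/
noncomputable def rangeArcs (t : Fin I.n) : List (Arc (4 * I.n) ℝ≥0) :=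
  I.edges.flatMap I.edgeArcs ++ (List.finRange I.n).flatMap (I.chainArcs t)

theorem length_rangeArcs (t : Fin I.n) : (I.rangeArcs t).length = 2 * I.m + 9 * I.n := by
  simp [rangeArcs, List.length_flatMap, edgeArcs, chainArcs, Instance.m]
  ring

/-- The trace on the original nodes of a set of nodes of the range network. -/
def trace (W : Finset (Fin (4 * I.n))) : Finset (Fin I.n) :=
  Finset.univ.filter fun v => (⟨v, by omega⟩ : Fin (4 * I.n)) ∈ W

theorem mem_trace {W : Finset (Fin (4 * I.n))} {v : Fin I.n} :
    v ∈ I.trace W ↔ (⟨v, by omega⟩ : Fin (4 * I.n)) ∈ W := by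
  simp [trace]

theorem cutCapacity_flatMap {n : ℕ} {R β : Type} [AddCommMonoid R] (l : List β)
    (f : β → List (Arc n R)) (S : Finset (Fin n)) :
    cutCapacity (l.flatMap f) S = (l.map fun b => cutCapacity (f b) S).sum := by
  induction l with
  | nil => simp [cutCapacity]
  | cons a l ih => simp [cutCapacity_append, ih]

theorem cutCapacity_edgeArcs (W : Finset (Fin (4 * I.n))) :
    cutCapacity (I.edges.flatMap I.edgeArcs) W = I.cut (I.trace W) := by
  rw [cutCapacity_flatMap, cut_eq_sum_add_sum, ← List.sum_map_add]
  simp [cutCapacity, edgeArcs, mem_trace]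

/-- The second and third chains hang on the source instead of the sink, so their predicates are
complemented. The third is read backwards with negated scalars, which turns a minimum into a
maximum. -/
theorem cutCapacity_chainArcs {t : Fin I.n} {W : Finset (Fin (4 * I.n))} {w : ℕ → Prop}
    (hw : ∀ x : Fin (4 * I.n), x ∈ W ↔ w x) (hs : w 0) (ht : ¬ w t) :
    ((cutCapacity ((List.finRange I.n).flatMap (I.chainArcs t)) W : ℝ≥0) : ℝ) =
      chainCost I.n I.width I.scalar w (fun k => w (I.n + k)) +
      chainCost I.n I.width I.scalar (fun k => ¬ w k) (fun k => ¬ w (2 * I.n + k)) +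
      chainCost I.n I.width (fun k => - I.scalar (I.n - 1 - k)) (fun k => ¬ w (I.n - 1 - k))
        (fun k => ¬ w (3 * I.n + k)) := by
  classical
  have hR := Real.coe_toNNReal _ I.width_nonneg
  rw [cutCapacity_flatMap, NNReal.coe_list_sum, List.map_map, ← Fin.sum_univ_def, chainCost,
    chainCost, chainCost, ← Finset.sum_add_distrib, ← Finset.sum_add_distrib, Finset.sum_range]
  refine Finset.sum_congr rfl fun k _ => ?_
  have hd := Real.coe_toNNReal _ (sub_nonneg.2 (I.scalar_mono (Nat.sub_le k.val 1) k.isLt))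
  have hd' := Real.coe_toNNReal _ (sub_nonneg.2 (I.scalar_mono
    (j := I.n - 1 - k) (k := I.n - 1 - (k - 1)) (by omega) (by omega)))
  have hif (p : Prop) [Decidable p] (x : ℝ≥0) :
    ((if p then x else 0 : ℝ≥0) : ℝ) = if p then (x : ℝ) else 0 := by split_ifs <;> rfl
  simp only [chainArcs, cutCapacity, hw, List.map_cons, List.map_nil, List.sum_cons, List.sum_nil,
    Function.comp_def, hs, ht, true_and, not_false_eq_true, and_true, not_not, NNReal.coe_add, hR,
    hd, hd', hif, NNReal.coe_zero, neg_sub_neg]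
  simp only [and_comm (b := w _)]
  ring_nf

/-- The chains pay at least `α M - α first`, `α N - α first` and `α last - α j`. The last two add up
to the range `α N - α j` of the complement plus `width`. -/
theorem objective_add_width_le {t : Fin I.n} {W : Finset (Fin (4 * I.n))}
    (hs : I.first ∈ I.trace W) (ht : t ∉ I.trace W) :
    I.objective (I.trace W) + I.width ≤ (cutCapacity (I.rangeArcs t) W : ℝ≥0) := by
  have hn := I.two_le
  set S := I.trace W with hS
  let w : ℕ → Prop := fun x => ∃ h : x < 4 * I.n, (⟨x, h⟩ : Fin (4 * I.n)) ∈ W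
  have hw : ∀ x : Fin (4 * I.n), x ∈ W ↔ w x := fun x => by simp [w]
  have hwS : ∀ v : Fin I.n, w v ↔ v ∈ S := fun v => by rw [hS, mem_trace, hw]
  have hmono : ∀ k < I.n, I.scalar (k - 1) ≤ I.scalar k :=
    fun k hk => I.scalar_mono (Nat.sub_le k 1) hk
  have hwidth : ∀ k < I.n, I.scalar k - I.scalar 0 ≤ I.width :=
    fun k hk => sub_le_sub_right (I.scalar_mono (by omega) (by omega)) _
  obtain ⟨M, hM, hMeq⟩ := Finset.exists_mem_eq_sup' ⟨_, hs⟩ I.α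
  have ht' : t ∈ Sᶜ := by simpa using ht
  obtain ⟨N, hN, hNeq⟩ := Finset.exists_mem_eq_sup' ⟨_, ht'⟩ I.α
  obtain ⟨j, hj, hjeq⟩ := Finset.exists_mem_eq_inf' ⟨_, ht'⟩ I.α
  have hr : I.range S ≤ I.α M - I.α I.first :=
    I.range_le ⟨_, hs⟩ fun x hx => ⟨I.first_le x, hMeq ▸ Finset.le_sup' I.α hx⟩
  have hr' : I.range Sᶜ = I.α N - I.α j := by rw [range, dif_pos ⟨_, ht'⟩, hNeq, hjeq]
  have h1 := le_chainCost (y := fun k => w (I.n + k)) hmono hwidth M.isLt ((hwS M).2 hM)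
  have h2 := le_chainCost (v := fun k => ¬ w k) (y := fun k => ¬ w (2 * I.n + k)) hmono hwidth
    N.isLt (by simpa [hwS] using hN)
  have hj' : I.n - 1 - (I.n - 1 - j.val) = j.val := by omega
  have h3 := le_chainCost (n := I.n) (R := I.width) (a := fun k => - I.scalar (I.n - 1 - k))
    (v := fun k => ¬ w (I.n - 1 - k)) (y := fun k => ¬ w (3 * I.n + k)) (M := I.n - 1 - j)
    (fun k hk => neg_le_neg (I.scalar_mono (by omega) (by omega)))
    (fun k hk => by
      have := I.scalar_mono (Nat.zero_le (I.n - 1 - k)) (by omega)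
      simp only [width, Nat.sub_zero]
      linarith) (by omega) (by simpa [hj', hwS] using hj)
  rw [rangeArcs, cutCapacity_append, NNReal.coe_add, I.cutCapacity_edgeArcs,
    I.cutCapacity_chainArcs hw ((hwS I.first).2 hs) (by simpa [hwS] using ht), objective, hr']
  simp only [hj', scalar_val, Nat.sub_zero] at h1 h2 h3
  have h0 : I.scalar 0 = I.α I.first := I.scalar_val I.first
  rw [← hS]
  simp only [width, h0] at *
  linarith

/-- Filling each chain exactly up to the extreme node that it encodes makes the three chain bounds
equalities. -/
theorem exists_cutCapacity_le {t : Fin I.n} {S : Finset (Fin I.n)} (hs : I.first ∈ S)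
    (ht : t ∉ S) : ∃ W : Finset (Fin (4 * I.n)), I.first ∈ I.trace W ∧ t ∉ I.trace W ∧
      ((cutCapacity (I.rangeArcs t) W : ℝ≥0) : ℝ) ≤ I.objective S + I.width := by
  classical
  have hn := I.two_le
  have ht' : t ∈ Sᶜ := by simpa using ht
  set M := S.max' ⟨_, hs⟩
  set N := Sᶜ.max' ⟨_, ht'⟩
  set j := Sᶜ.min' ⟨_, ht'⟩
  have hM : M ∈ S := S.max'_mem _
  have hN : N ∈ Sᶜ := Sᶜ.max'_mem _
  have hj : j ∈ Sᶜ := Sᶜ.min'_mem _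
  have hMle : ∀ v ∈ S, v.val ≤ M.val := fun v hv => Fin.le_def.1 (S.le_max' v hv)
  have hNle : ∀ v ∉ S, v.val ≤ N.val :=
    fun v hv => Fin.le_def.1 (Sᶜ.le_max' v (by simpa using hv))
  have hjle : ∀ v ∉ S, j.val ≤ v.val :=
    fun v hv => Fin.le_def.1 (Sᶜ.min'_le v (by simpa using hv))
  -- The four blocks of `n` nodes are the original nodes and the three chains; the last two are
  -- negated because they hang on the source.
  let w : ℕ → Prop := fun x =>
    if h : x < I.n then (⟨x, h⟩ : Fin I.n) ∈ S
    else if x < 2 * I.n then x - I.n ≤ M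
    else if x < 3 * I.n then ¬ x - 2 * I.n ≤ N
    else ¬ x - 3 * I.n ≤ I.n - 1 - j
  let W : Finset (Fin (4 * I.n)) := Finset.univ.filter fun x => w x
  have hw : ∀ x : Fin (4 * I.n), x ∈ W ↔ w x := fun x => by simp [W]
  have hwS : ∀ v : Fin I.n, w v ↔ v ∈ S := fun v => by simp [w]
  have htr : I.trace W = S := by ext v; rw [mem_trace, hw, hwS]
  refine ⟨W, htr ▸ hs, htr ▸ ht, ?_⟩
  rw [rangeArcs, cutCapacity_append, NNReal.coe_add, I.cutCapacity_edgeArcs, htr,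
    I.cutCapacity_chainArcs hw ((hwS I.first).2 hs) (by simpa [hwS] using ht), objective]
  have hcongr (a : ℕ → ℝ) (v y y' : ℕ → Prop) (h : ∀ k < I.n, y k ↔ y' k) :
      chainCost I.n I.width a v y = chainCost I.n I.width a v y' := by
    refine Finset.sum_congr rfl fun k hk => ?_
    have hk := Finset.mem_range.1 hk
    simp only [h k hk, h (k - 1) (by omega)]
  rw [hcongr _ _ (fun k => w (I.n + k)) (fun k => k ≤ M) fun k hk => by
      simp only [w]
      rw [dif_neg (by omega), if_pos (by omega), Nat.add_sub_cancel_left],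
    hcongr _ _ (fun k => ¬ w (2 * I.n + k)) (fun k => k ≤ N) fun k hk => by
      simp only [w]
      rw [dif_neg (by omega), if_neg (by omega), if_pos (by omega), Nat.add_sub_cancel_left,
        not_not],
    hcongr _ _ (fun k => ¬ w (3 * I.n + k)) (fun k => k ≤ I.n - 1 - j) fun k hk => by
      simp only [w]
      rw [dif_neg (by omega), if_neg (by omega), if_neg (by omega), Nat.add_sub_cancel_left,
        not_not],
    chainCost_le_eq M.isLt fun k hk hv => hMle ⟨k, hk⟩ ((hwS ⟨k, hk⟩).1 hv),
    chainCost_le_eq N.isLt fun k hk hv => hNle ⟨k, hk⟩ fun h => hv ((hwS ⟨k, hk⟩).2 h),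
    chainCost_le_eq (by omega) fun k hk hv => by
      have := hjle ⟨I.n - 1 - k, by omega⟩ fun h => hv ((hwS ⟨I.n - 1 - k, by omega⟩).2 h)
      simp only at this
      omega]
  have h1 := I.sub_le_range hM hs
  have h2 := I.sub_le_range hN hj
  have h0 : I.scalar 0 = I.α I.first := I.scalar_val I.first
  have hj' : I.n - 1 - (I.n - 1 - j.val) = j.val := by omega
  simp only [hj', scalar_val, Nat.sub_zero, width, h0]
  linarith

/-- The range network with source `0` and sink `t`. -/
noncomputable def rangeNetwork (t : Fin I.n) (ht : t ≠ I.first) : STNetwork where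
  nodes := 4 * I.n
  arcs := I.rangeArcs t
  source := ⟨I.first, by omega⟩
  sink := ⟨t, by omega⟩
  source_ne_sink := fun h => ht (Fin.ext (congrArg Fin.val h).symm)

/-- The two preceding bounds sandwich the capacity; the trace itself as competitor gives equality.
Thus the program can read the objective off the capacity, without computing ranges. -/
theorem trace_minCut {O : (N : STNetwork) → Finset (Fin N.nodes)} (hO : IsMinCutProcedure O)
    (t : Fin I.n) (ht : t ≠ I.first) :
    I.first ∈ I.trace (O (I.rangeNetwork t ht)) ∧ t ∉ I.trace (O (I.rangeNetwork t ht)) ∧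
    ((cutCapacity (I.rangeArcs t) (O (I.rangeNetwork t ht)) : ℝ≥0) : ℝ) =
      I.objective (I.trace (O (I.rangeNetwork t ht))) + I.width ∧
    ∀ S, I.first ∈ S → t ∉ S → I.objective (I.trace (O (I.rangeNetwork t ht))) ≤ I.objective S := by
  obtain ⟨h1, h2, h3⟩ := hO (I.rangeNetwork t ht)
  have h1' := I.mem_trace.2 h1
  have h2' : t ∉ I.trace (O (I.rangeNetwork t ht)) := fun h => h2 (I.mem_trace.1 h)
  have hle := I.objective_add_width_le h1' h2'
  have hmin : ∀ S, I.first ∈ S → t ∉ S →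
      ((cutCapacity (I.rangeArcs t) (O (I.rangeNetwork t ht)) : ℝ≥0) : ℝ) ≤
        I.objective S + I.width := by
    intro S hS hS'
    obtain ⟨W, hW1, hW2, hW3⟩ := I.exists_cutCapacity_le hS hS'
    exact (NNReal.coe_le_coe.2 (h3 W (I.mem_trace.1 hW1) fun h => hW2 (I.mem_trace.2 h))).trans hW3
  refine ⟨h1', h2', le_antisymm (hmin _ h1' h2') hle, fun S hS hS' => ?_⟩
  linarith [hmin S hS hS']

end Instance

/-! ### Running programs with a time bound -/

/-- The memory of the program for the min range cut problem, apart from the input. -/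
structure Store where
  out : ℕ → ℕ
  tail : ℕ → ℕ
  head : ℕ → ℕ
  side : ℕ → ℕ
  sink : ℕ
  ptr : ℕ
  idx : ℕ
  z : ℝ
  cap : ℕ → ℝ
  acc : ℝ

/-- The array with `x` in its first cell and zeros elsewhere. -/
def cell {β : Type} [Zero β] (x : β) : ℕ → β := Function.update (fun _ => 0) 0 x

/-- The input together with a store. -/
noncomputable def Store.memory (I : Instance) (s : Store) : Memory where
  nat a := match a with
    | 0 => I.input.nat 0
    | 1 => I.input.nat 1
    | 2 => I.input.nat 2
    | 3 => s.out
    | 4 => s.tail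
    | 5 => s.head
    | 6 => s.side
    | 7 => cell s.sink
    | 8 => cell s.ptr
    | 9 => cell s.idx
    | _ => fun _ => 0
  real a := match a with
    | 0 => I.input.real 0
    | 1 => I.input.real 1
    | 2 => cell s.z
    | 3 => s.cap
    | 4 => cell s.acc
    | _ => fun _ => 0

/-- The empty store. -/
def Store.empty : Store :=
  ⟨fun _ => 0, fun _ => 0, fun _ => 0, fun _ => 0, 0, 0, 0, 0, fun _ => 0, 0⟩

@[simp] theorem cell_zero_apply {β : Type} [Zero β] (x : β) : cell x 0 = x := by simp [cell]

theorem cell_zero {β : Type} [Zero β] : cell (0 : β) = fun _ => 0 := by simp [cell]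

@[simp] theorem update_cell {β : Type} [Zero β] (x y : β) :
    Function.update (cell x) 0 y = cell y := by simp [cell]

theorem memory_empty (I : Instance) : Store.empty.memory I = I.input := by
  unfold Store.memory Instance.input
  simp only [Store.empty, cell_zero, Memory.mk.injEq]
  constructor
  · funext a
    rcases a with _ | _ | _ | _ | _ | _ | _ | _ | _ | _ | a <;> simp
  · funext a
    rcases a with _ | _ | _ | _ | _ | a <;> simp

section SetMemory

variable (I : Instance) (s : Store)

theorem memory_setNat (a i x : ℕ) (s' : Store)
    (h : (s'.memory I).nat = Function.update (s.memory I).nat a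
      (Function.update ((s.memory I).nat a) i x)) (h' : (s'.memory I).real = (s.memory I).real) :
    (s.memory I).setNat a i x = s'.memory I := by
  rw [Memory.setNat, ← h, ← h']

theorem setNat_out (i x : ℕ) : (s.memory I).setNat 3 i x =
    Store.memory I { s with out := Function.update s.out i x } := by
  refine memory_setNat I s _ _ _ _ (funext fun a => ?_) rfl
  rcases a with _ | _ | _ | _ | _ | _ | _ | _ | _ | _ | a <;> simp [Store.memory, Function.update]

theorem setNat_tail (i x : ℕ) : (s.memory I).setNat 4 i x =
    Store.memory I { s with tail := Function.update s.tail i x } := by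
  refine memory_setNat I s _ _ _ _ (funext fun a => ?_) rfl
  rcases a with _ | _ | _ | _ | _ | _ | _ | _ | _ | _ | a <;> simp [Store.memory, Function.update]

theorem setNat_head (i x : ℕ) : (s.memory I).setNat 5 i x =
    Store.memory I { s with head := Function.update s.head i x } := by
  refine memory_setNat I s _ _ _ _ (funext fun a => ?_) rfl
  rcases a with _ | _ | _ | _ | _ | _ | _ | _ | _ | _ | a <;> simp [Store.memory, Function.update]

theorem setNat_sink (x : ℕ) : (s.memory I).setNat 7 0 x =
    Store.memory I { s with sink := x } := by
  refine memory_setNat I s _ _ _ _ (funext fun a => ?_) rfl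
  rcases a with _ | _ | _ | _ | _ | _ | _ | _ | _ | _ | a <;> simp [Store.memory]

theorem setNat_ptr (x : ℕ) : (s.memory I).setNat 8 0 x =
    Store.memory I { s with ptr := x } := by
  refine memory_setNat I s _ _ _ _ (funext fun a => ?_) rfl
  rcases a with _ | _ | _ | _ | _ | _ | _ | _ | _ | _ | a <;> simp [Store.memory]

theorem setNat_idx (x : ℕ) : (s.memory I).setNat 9 0 x =
    Store.memory I { s with idx := x } := by
  refine memory_setNat I s _ _ _ _ (funext fun a => ?_) rfl
  rcases a with _ | _ | _ | _ | _ | _ | _ | _ | _ | _ | a <;> simp [Store.memory]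

theorem memory_setReal (a i : ℕ) (x : ℝ) (s' : Store)
    (h : (s'.memory I).real = Function.update (s.memory I).real a
      (Function.update ((s.memory I).real a) i x)) (h' : (s'.memory I).nat = (s.memory I).nat) :
    (s.memory I).setReal a i x = s'.memory I := by
  rw [Memory.setReal, ← h, ← h']

theorem setReal_z (x : ℝ) : (s.memory I).setReal 2 0 x =
    Store.memory I { s with z := x } := by
  refine memory_setReal I s _ _ _ _ (funext fun a => ?_) rfl
  rcases a with _ | _ | _ | _ | _ | a <;> simp [Store.memory]

theorem setReal_cap (i : ℕ) (x : ℝ) : (s.memory I).setReal 3 i x =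
    Store.memory I { s with cap := Function.update s.cap i x } := by
  refine memory_setReal I s _ _ _ _ (funext fun a => ?_) rfl
  rcases a with _ | _ | _ | _ | _ | a <;> simp [Store.memory, Function.update]

theorem setReal_acc (x : ℝ) : (s.memory I).setReal 4 0 x =
    Store.memory I { s with acc := x } := by
  refine memory_setReal I s _ _ _ _ (funext fun a => ?_) rfl
  rcases a with _ | _ | _ | _ | _ | a <;> simp [Store.memory]

end SetMemory

/-- The program `p`, started with the store `s`, halts within `b` steps with a store in `Q`. -/
def Runs (O : (N : STNetwork) → Finset (Fin N.nodes)) (T : ℕ → ℕ → ℕ) (I : Instance)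
    (p : Program) (s : Store) (b : ℕ) (Q : Store → Prop) : Prop :=
  ∃ c s', Exec O T p (s.memory I) c (s'.memory I) ∧ c ≤ b ∧ Q s'

section Runs

variable {O : (N : STNetwork) → Finset (Fin N.nodes)} {T : ℕ → ℕ → ℕ} {I : Instance}
  {p p' : Program} {s : Store} {b b' : ℕ} {Q Q' : Store → Prop}

theorem Runs.mono (h : Runs O T I p s b Q) (hb : b ≤ b') (hQ : ∀ s, Q s → Q' s) :
    Runs O T I p s b' Q' := by
  obtain ⟨c, s', h1, h2, h3⟩ := h
  exact ⟨c, s', h1, h2.trans hb, hQ _ h3⟩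

theorem Runs.seq (h : Runs O T I p s b Q) (h' : ∀ s', Q s' → Runs O T I p' s' b' Q') :
    Runs O T I (.seq p p') s (b + b') Q' := by
  obtain ⟨c, s', h1, h2, h3⟩ := h
  obtain ⟨c', s'', h4, h5, h6⟩ := h' s' h3
  exact ⟨c + c', s'', h1.seq h4, by omega, h6⟩

theorem Runs.skip (h : Q s) : Runs O T I .skip s 1 Q :=
  ⟨1, s, .skip _, le_rfl, h⟩

theorem Runs.setNat {a : ℕ} {i x : NatExp} (s' : Store)
    (h : (s.memory I).setNat a (i.eval (s.memory I)) (x.eval (s.memory I)) = s'.memory I)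
    (hQ : Q s') : Runs O T I (.setNat a i x) s 1 Q :=
  ⟨1, s', h ▸ .setNat _ a i x, le_rfl, hQ⟩

theorem Runs.setReal {a : ℕ} {i : NatExp} {x : RealExp} (s' : Store)
    (h : (s.memory I).setReal a (i.eval (s.memory I)) (x.eval (s.memory I)) = s'.memory I)
    (hQ : Q s') : Runs O T I (.setReal a i x) s 1 Q :=
  ⟨1, s', h ▸ .setReal _ a i x, le_rfl, hQ⟩

theorem Runs.ite {t : Test} (h : t.holds (s.memory I) → Runs O T I p s b Q)
    (h' : ¬ t.holds (s.memory I) → Runs O T I p' s b Q) :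
    Runs O T I (.ite t p p') s (b + 1) Q := by
  by_cases ht : t.holds (s.memory I)
  · obtain ⟨c, s', h1, h2, h3⟩ := h ht
    exact ⟨c + 1, s', .iteTrue ht h1, by omega, h3⟩
  · obtain ⟨c, s', h1, h2, h3⟩ := h' ht
    exact ⟨c + 1, s', .iteFalse ht h1, by omega, h3⟩

/-- A loop with `k` rounds of at most `b` steps each. -/
theorem Runs.whileLoop {t : Test} (Inv : ℕ → Store → Prop) (k : ℕ)
    (hbody : ∀ j < k, ∀ s, Inv j s → t.holds (s.memory I) ∧ Runs O T I p s b (Inv (j + 1)))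
    (hexit : ∀ s, Inv k s → ¬ t.holds (s.memory I)) (h0 : Inv 0 s) :
    Runs O T I (.while t p) s (k * (b + 1) + 1) (Inv k) := by
  suffices H : ∀ d j s, j + d = k → Inv j s →
      Runs O T I (.while t p) s (d * (b + 1) + 1) (Inv k) from H k 0 s (by omega) h0
  intro d
  induction d with
  | zero =>
    intro j s hj hs
    obtain rfl : j = k := by omega
    exact ⟨1, s, .whileFalse (hexit s hs), by omega, hs⟩
  | succ d ih =>
    intro j s hj hs
    obtain ⟨ht, c, s', h1, h2, h3⟩ := hbody j (by omega) s hs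
    obtain ⟨c', s'', h4, h5, h6⟩ := ih (j + 1) s' (by omega) h3
    refine ⟨c + c' + 1, s'', .whileTrue ht h1 h4, ?_, h6⟩
    rw [add_mul]
    omega

end Runs

/-! ### The program -/

namespace Code

def idx : NatExp := .get 9 (.lit 0)
def ptr : NatExp := .get 8 (.lit 0)
def sink : NatExp := .get 7 (.lit 0)
def nodes : NatExp := .get 0 (.lit 0)
def edges : NatExp := .get 0 (.lit 1)
def acc : RealExp := .get 4 (.lit 0)
def best : RealExp := .get 2 (.lit 0)

/-- Run `p` with the values `0, …, k - 1` of the index. -/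
def forIdx (k : NatExp) (p : Program) : Program :=
  .seq (.setNat 9 (.lit 0) (.lit 0))
    (.while (.natLt idx k) (.seq p (.setNat 9 (.lit 0) (.add idx (.lit 1)))))

/-- Append an arc to the network. -/
def emit (u v : NatExp) (c : RealExp) : Program :=
  .seq (.setNat 4 ptr u) (.seq (.setNat 5 ptr v)
    (.seq (.setReal 3 ptr c) (.setNat 8 (.lit 0) (.add ptr (.lit 1)))))

/-- Append a list of arcs to the network. -/
def emitAll : List (NatExp × NatExp × RealExp) → Program
  | [] => .skip
  | e :: l => .seq (emit e.1 e.2.1 e.2.2) (emitAll l)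

/-- The two arcs along the edge `idx`. -/
def edgeArcs : List (NatExp × NatExp × RealExp) :=
  [(.get 1 idx, .get 2 idx, .get 0 idx), (.get 2 idx, .get 1 idx, .get 0 idx)]

def twoNodes : NatExp := .add nodes nodes
def threeNodes : NatExp := .add twoNodes nodes
def last : NatExp := .sub nodes (.lit 1)
def pred : NatExp := .sub idx (.lit 1)
def width : RealExp := .sub (.get 1 last) (.get 1 (.lit 0))
def gap : RealExp := .sub (.get 1 idx) (.get 1 pred)
def revGap : RealExp := .sub (.get 1 (.sub last pred)) (.get 1 (.sub last idx))

/-- The arcs of the three chains at the position `idx`. -/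
def chainArcs : List (NatExp × NatExp × RealExp) :=
  [(idx, .add nodes idx, width),
   (.add nodes idx, .add nodes pred, width),
   (.add nodes idx, sink, gap),
   (.add twoNodes idx, idx, width),
   (.add twoNodes pred, .add twoNodes idx, width),
   (.lit 0, .add twoNodes idx, gap),
   (.add threeNodes idx, .sub last idx, width),
   (.add threeNodes pred, .add threeNodes idx, width),
   (.lit 0, .add threeNodes idx, revGap)]

/-- Build the range network. -/
def build : Program :=
  .seq (.setNat 8 (.lit 0) (.lit 0))
    (.seq (forIdx edges (emitAll edgeArcs)) (forIdx nodes (emitAll chainArcs)))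

/-- Compute the capacity of the cut, minus the width. -/
def evaluate : Program :=
  .seq (.setReal 4 (.lit 0) (.sub (.get 1 (.lit 0)) (.get 1 last)))
    (forIdx ptr (.ite (.natLt (.get 6 (.get 5 idx)) (.get 6 (.get 4 idx)))
      (.setReal 4 (.lit 0) (.add acc (.get 3 idx))) .skip))

/-- Replace the incumbent. -/
def copy : Program :=
  .seq (.setReal 2 (.lit 0) acc) (forIdx nodes (.setNat 3 idx (.get 6 idx)))

/-- Replace the incumbent in the first round, and whenever the new value is smaller. -/
def improve : Program :=
  .ite (.natLt sink (.lit 2)) copy (.ite (.realLt acc best) copy .skip)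

/-- One round: find the best partition that separates `0` and `sink`. -/
def round : Program :=
  .seq build (.seq (.minCut (.add twoNodes twoNodes) ptr (.lit 0) sink 4 5 3 6)
    (.seq evaluate (.seq improve (.setNat 7 (.lit 0) (.add sink (.lit 1))))))

/-- The program for the min range cut problem. -/
def main : Program :=
  .seq (.setNat 7 (.lit 0) (.lit 1)) (.while (.natLt sink nodes) round)

end Code

/-! ### Correctness and step count of the program -/

section Program

variable {O : (N : STNetwork) → Finset (Fin N.nodes)} {T : ℕ → ℕ → ℕ} {I : Instance}

section Eval

variable (I : Instance) (s : Store)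

@[simp] theorem eval_idx : Code.idx.eval (s.memory I) = s.idx := by
  simp [Code.idx, NatExp.eval, Store.memory]

@[simp] theorem eval_ptr : Code.ptr.eval (s.memory I) = s.ptr := by
  simp [Code.ptr, NatExp.eval, Store.memory]

@[simp] theorem eval_sink : Code.sink.eval (s.memory I) = s.sink := by
  simp [Code.sink, NatExp.eval, Store.memory]

@[simp] theorem eval_nodes : Code.nodes.eval (s.memory I) = I.n := by
  simp [Code.nodes, NatExp.eval, Store.memory, Instance.input]

@[simp] theorem eval_edges : Code.edges.eval (s.memory I) = I.m := by
  simp [Code.edges, NatExp.eval, Store.memory, Instance.input]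

@[simp] theorem eval_acc : Code.acc.eval (s.memory I) = s.acc := by
  simp [Code.acc, RealExp.eval, NatExp.eval, Store.memory]

@[simp] theorem eval_best : Code.best.eval (s.memory I) = s.z := by
  simp [Code.best, RealExp.eval, NatExp.eval, Store.memory]

@[simp] theorem real_one (k : ℕ) : (s.memory I).real 1 k = I.scalar k := by
  simp [Store.memory, Instance.input, Instance.scalar]

theorem real_zero {k : ℕ} (h : k < I.edges.length) :
    (s.memory I).real 0 k = (I.edges[k]).weight := by
  simp [Store.memory, Instance.input, h]

theorem nat_one {k : ℕ} (h : k < I.edges.length) : (s.memory I).nat 1 k = (I.edges[k]).u := by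
  simp [Store.memory, Instance.input, h]

theorem nat_two {k : ℕ} (h : k < I.edges.length) : (s.memory I).nat 2 k = (I.edges[k]).v := by
  simp [Store.memory, Instance.input, h]

@[simp] theorem eval_width : Code.width.eval (s.memory I) = I.width := by
  simp [Code.width, Code.last, RealExp.eval, NatExp.eval, Instance.width]

end Eval

/-- Each round adds a test and an increment to the body; the final `2` pays for the initialization
and the failing test. -/
theorem Runs.forIdx {k : NatExp} {p : Program} {s : Store} {b : ℕ} (Inv : ℕ → Store → Prop)
    (m : ℕ) (h0 : Inv 0 { s with idx := 0 })
    (hinv : ∀ j s, Inv j s → k.eval (s.memory I) = m ∧ s.idx = j)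
    (hbody : ∀ j < m, ∀ s, Inv j s →
      Runs O T I p s b fun s' => Inv (j + 1) { s' with idx := s'.idx + 1 }) :
    Runs O T I (Code.forIdx k p) s (m * (b + 2) + 2) (Inv m) := by
  refine ((Runs.setNat { s with idx := 0 } (setNat_idx I s _) h0).seq fun s' hs' =>
    Runs.whileLoop (b := b + 1) Inv m (fun j hj s hs => ⟨?_, ?_⟩) (fun s hs => ?_) hs').mono
    (by rw [Nat.add_assoc b]; omega) fun _ h => h
  · obtain ⟨h1, h2⟩ := hinv j s hs
    simpa [Test.holds, h1, h2] using hj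
  · refine (hbody j hj s hs).seq fun s' hs' => Runs.setNat _ (setNat_idx I s' _) ?_
    simpa [NatExp.eval] using hs'
  · obtain ⟨h1, h2⟩ := hinv m s hs
    simp [Test.holds, h1, h2]

/-- The arcs in `L` are stored as the current network. -/
structure Store.Holds {N : ℕ} (s : Store) (L : List (Arc N ℝ≥0)) : Prop where
  ptr_eq : s.ptr = L.length
  arc_eq : ∀ (k : ℕ) (h : k < L.length),
    s.tail k = (L[k]).tail ∧ s.head k = (L[k]).head ∧ s.cap k = (L[k]).cap

/-- The fields of the store that do not change while the network is built. -/
structure Store.Frame (s s' : Store) : Prop where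
  sink_eq : s'.sink = s.sink
  idx_eq : s'.idx = s.idx
  out_eq : s'.out = s.out
  z_eq : s'.z = s.z

/-- The arc `a` is described by expressions that depend only on the input, `sink` and `idx`. -/
def Describes (I : Instance) (t k : ℕ) {N : ℕ} (e : NatExp × NatExp × RealExp)
    (a : Arc N ℝ≥0) : Prop :=
  ∀ s : Store, s.sink = t → s.idx = k → e.1.eval (s.memory I) = a.tail ∧
    e.2.1.eval (s.memory I) = a.head ∧ e.2.2.eval (s.memory I) = a.cap

/-- The three expressions are evaluated in successive, already modified memories. `Describes` covers
this, as it allows any store with the same `sink` and `idx`. -/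
theorem runs_emit {N : ℕ} {s : Store} {L : List (Arc N ℝ≥0)} (hL : s.Holds L)
    {e : NatExp × NatExp × RealExp} {a : Arc N ℝ≥0} (he : Describes I s.sink s.idx e a) :
    Runs O T I (Code.emit e.1 e.2.1 e.2.2) s 4 fun s' => s.Frame s' ∧ s'.Holds (L ++ [a]) := by
  refine (Runs.setNat (Q := fun s' => s' = _) _ (setNat_tail I s _ _) rfl).seq (b' := 3)
    fun s₁ h₁ => ?_
  refine (Runs.setNat (Q := fun s' => s' = _) _ (setNat_head I s₁ _ _) rfl).seq (b' := 2)
    fun s₂ h₂ => ?_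
  refine (Runs.setReal (Q := fun s' => s' = _) _ (setReal_cap I s₂ _ _) rfl).seq (b' := 1)
    fun s₃ h₃ => ?_
  rw [eval_ptr, (he s rfl rfl).1] at h₁
  rw [eval_ptr, (he s₁ (by rw [h₁]) (by rw [h₁])).2.1] at h₂
  rw [eval_ptr, (he s₂ (by rw [h₂, h₁]) (by rw [h₂, h₁])).2.2] at h₃
  subst h₁ h₂ h₃
  refine Runs.setNat _ (setNat_ptr I _ _) ⟨⟨rfl, rfl, rfl, rfl⟩, ?_, fun k hk => ?_⟩
  · simp [NatExp.eval, hL.ptr_eq]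
  · simp only [hL.ptr_eq]
    simp only [List.length_append, List.length_singleton] at hk
    by_cases hk' : k < L.length
    · rw [List.getElem_append_left hk']
      simpa [Function.update, hk'.ne] using hL.arc_eq k hk'
    · obtain rfl : k = L.length := by omega
      simp

theorem runs_emitAll {N : ℕ} {t k : ℕ} {es : List (NatExp × NatExp × RealExp)}
    {as : List (Arc N ℝ≥0)} (h : List.Forall₂ (Describes I t k) es as) {s : Store}
    {L : List (Arc N ℝ≥0)} (hL : s.Holds L) (ht : s.sink = t) (hk : s.idx = k) :
    Runs O T I (Code.emitAll es) s (4 * es.length + 1)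
      fun s' => s.Frame s' ∧ s'.Holds (L ++ as) := by
  induction h generalizing s L with
  | nil => exact Runs.skip ⟨⟨rfl, rfl, rfl, rfl⟩, by simpa using hL⟩
  | @cons e a es as he _ ih =>
    refine (Runs.seq (b' := 4 * es.length + 1) (runs_emit hL (by rwa [ht, hk])) fun s' hs' =>
      (ih hs'.2 (hs'.1.sink_eq.trans ht) (hs'.1.idx_eq.trans hk)).mono le_rfl ?_).mono
      (by simp only [List.length_cons]; omega) fun _ h => h
    rintro s'' ⟨h1, h2⟩
    exact ⟨⟨h1.1.trans hs'.1.1, h1.2.trans hs'.1.2, h1.3.trans hs'.1.3, h1.4.trans hs'.1.4⟩,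
      by simpa using h2⟩

theorem describes_edgeArcs (t k : ℕ) (hk : k < I.edges.length) :
    List.Forall₂ (Describes I t k) Code.edgeArcs (I.edgeArcs I.edges[k]) := by
  simp only [Code.edgeArcs, Instance.edgeArcs, List.forall₂_cons, List.forall₂_nil_left_iff]
  refine ⟨?_, ?_, trivial⟩ <;> intro s _ h2 <;>
    simp [NatExp.eval, RealExp.eval, h2, real_zero I s hk, nat_one I s hk, nat_two I s hk]

theorem describes_chainArcs (t k : Fin I.n) :
    List.Forall₂ (Describes I t k) Code.chainArcs (I.chainArcs t k) := by
  -- The program computes real differences; being nonnegative, they are not changed by `toNNReal`.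
  have hR := Real.coe_toNNReal _ I.width_nonneg
  have hd := Real.coe_toNNReal _ (sub_nonneg.2 (I.scalar_mono (Nat.sub_le k.val 1) k.isLt))
  have hd' := Real.coe_toNNReal _ (sub_nonneg.2 (I.scalar_mono
    (j := I.n - 1 - k) (k := I.n - 1 - (k - 1)) (by omega) (by omega)))
  simp only [Code.chainArcs, Instance.chainArcs, List.forall₂_cons, List.forall₂_nil_left_iff]
  refine ⟨?_, ?_, ?_, ?_, ?_, ?_, ?_, ?_, ?_, trivial⟩ <;> intro s h1 h2 <;>
    simp only [NatExp.eval, RealExp.eval, Code.gap, Code.revGap, Code.pred, Code.last,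
      Code.twoNodes, Code.threeNodes, eval_idx, eval_nodes, eval_sink, eval_width, real_one, h1, h2,
      hR, hd, hd', true_and, and_true] <;> omega

theorem Store.Holds.congr {N : ℕ} {s s' : Store} {L : List (Arc N ℝ≥0)} (h : s.Holds L)
    (hp : s'.ptr = s.ptr) (ht : s'.tail = s.tail) (hh : s'.head = s.head) (hc : s'.cap = s.cap) :
    s'.Holds L :=
  ⟨hp.trans h.ptr_eq, by rw [ht, hh, hc]; exact h.arc_eq⟩

theorem flatMap_take_succ {β γ : Type} (l : List β) (f : β → List γ) {j : ℕ} (hj : j < l.length) :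
    (l.take (j + 1)).flatMap f = (l.take j).flatMap f ++ f l[j] := by
  simp [← List.take_append_getElem hj, -List.take_append_getElem]

/-- Appending the arcs of `l.flatMap f` in a loop. -/
theorem runs_forIdx_emitAll {N : ℕ} {β : Type} {k : NatExp} (l : List β)
    (f : β → List (Arc N ℝ≥0)) {es : List (NatExp × NatExp × RealExp)} {s : Store}
    {L : List (Arc N ℝ≥0)} (hL : s.Holds L) (hk : ∀ s : Store, k.eval (s.memory I) = l.length)
    (hes : ∀ (j : ℕ) (hj : j < l.length), List.Forall₂ (Describes I s.sink j) es (f l[j])) :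
    Runs O T I (Code.forIdx k (Code.emitAll es)) s (l.length * (4 * es.length + 3) + 2)
      fun s' => s'.sink = s.sink ∧ s'.out = s.out ∧ s'.z = s.z ∧ s'.Holds (L ++ l.flatMap f) := by
  refine (Runs.forIdx (b := 4 * es.length + 1) (fun j s' => s'.idx = j ∧ s'.sink = s.sink ∧
    s'.out = s.out ∧ s'.z = s.z ∧ s'.Holds (L ++ (l.take j).flatMap f)) l.length ?_ ?_ ?_).mono
    le_rfl ?_
  · exact ⟨rfl, rfl, rfl, rfl, by
    simpa using hL.congr (s' := { s with idx := 0 }) rfl rfl rfl rfl⟩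
  · exact fun j s' h => ⟨hk s', h.1⟩
  · rintro j hj s' ⟨h1, h2, h3, h4, h5⟩
    refine (runs_emitAll (hes j hj) h5 h2 h1).mono le_rfl ?_
    rintro s'' ⟨h6, h7⟩
    refine ⟨by simp [h6.idx_eq, h1], h6.sink_eq.trans h2, h6.out_eq.trans h3, h6.z_eq.trans h4, ?_⟩
    rw [flatMap_take_succ l f hj, ← List.append_assoc]
    exact h7.congr rfl rfl rfl rfl
  · rintro s' ⟨-, h2, h3, h4, h5⟩
    exact ⟨h2, h3, h4, by simpa using h5⟩

/-- An arc takes four steps and a round three more: `4 * 2 + 3 = 11` per edge and `4 * 9 + 3 = 39`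
per node. -/
theorem runs_build (s : Store) (t : Fin I.n) (ht : s.sink = t) :
    Runs O T I Code.build s (11 * I.m + 39 * I.n + 5)
      fun s' => s'.sink = s.sink ∧ s'.out = s.out ∧ s'.z = s.z ∧ s'.Holds (I.rangeArcs t) := by
  refine ((Runs.setNat (Q := fun s' => s' = _) _ (setNat_ptr I s _) rfl).seq fun s₁ h₁ => ?_).mono
    (b := 1 + ((I.edges.length * 11 + 2) + ((List.finRange I.n).length * 39 + 2)))
    (by simp only [List.length_finRange, Instance.m]; omega) fun _ h => h
  have h0 : s₁.Holds (N := 4 * I.n) [] := ⟨by rw [h₁]; simp [NatExp.eval], by simp⟩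
  have ht₁ : s₁.sink = t := by rw [h₁]; exact ht
  refine (runs_forIdx_emitAll I.edges I.edgeArcs h0 (by simp [Instance.m])
    fun j hj => describes_edgeArcs _ j hj).seq ?_
  rintro s₂ ⟨h2, h3, h4, h5⟩
  refine (runs_forIdx_emitAll (List.finRange I.n) (I.chainArcs t) h5 (by simp)
    fun j hj => ?_).mono le_rfl ?_
  · rw [h2, ht₁]
    have := describes_chainArcs t (List.finRange I.n)[j]
    simpa using this
  · rintro s₃ ⟨h6, h7, h8, h9⟩
    subst h₁
    exact ⟨h6.trans h2, h7.trans h3, h8.trans h4, h9⟩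

theorem runs_minCut {s : Store} (t : Fin I.n) (ht : t ≠ I.first) (hs : s.sink = t)
    (hL : s.Holds (I.rangeArcs t)) :
    Runs O T I (.minCut (.add Code.twoNodes Code.twoNodes) Code.ptr (.lit 0) Code.sink 4 5 3 6) s
      (T (2 * I.m + 9 * I.n) (4 * I.n))
      fun s' => ∃ side, s' = { s with side := side } ∧
        ∀ x : Fin (4 * I.n), (x ∈ O (I.rangeNetwork t ht) → side x = 1) ∧
          (x ∉ O (I.rangeNetwork t ht) → side x = 0) := by
  classical
  have hG : (I.rangeNetwork t ht).StoredAt (s.memory I) (.add Code.twoNodes Code.twoNodes)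
      Code.ptr (.lit 0) Code.sink 4 5 3 := by
    refine ⟨?_, ?_, rfl, ?_, hL.arc_eq⟩
    · simp only [NatExp.eval, Code.twoNodes, eval_nodes, Instance.rangeNetwork]; ring
    · simp [Instance.rangeNetwork, hL.ptr_eq]
    · simp [Instance.rangeNetwork, hs]
  let side : ℕ → ℕ := ((s.memory I).writeSet 6 (O (I.rangeNetwork t ht))).nat 6
  have hw : (s.memory I).writeSet 6 (O (I.rangeNetwork t ht)) =
      Store.memory I { s with side := side } := by
    simp only [side, Memory.writeSet, Store.memory, Memory.mk.injEq, and_true]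
    funext a
    rcases a with _ | _ | _ | _ | _ | _ | _ | _ | _ | _ | a <;> simp [Function.update]
  refine ⟨_, { s with side := side }, hw ▸ Exec.minCut _ hG, ?_, side, rfl, fun x => ?_⟩
  · simp [Instance.rangeNetwork, I.length_rangeArcs]
  · have hx : x.val < (I.rangeNetwork t ht).nodes := x.isLt
    simp only [side, Memory.writeSet, Function.update_self, dif_pos hx]
    exact ⟨fun h => if_pos h, fun h => if_neg h⟩

theorem cutCapacity_take_succ {n : ℕ} (L : List (Arc n ℝ≥0)) (W : Finset (Fin n)) {j : ℕ}
    (hj : j < L.length) : cutCapacity (L.take (j + 1)) W = cutCapacity (L.take j) W +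
      if L[j].tail ∈ W ∧ L[j].head ∉ W then L[j].cap else 0 := by
  rw [← List.take_append_getElem hj, cutCapacity_append]
  simp [cutCapacity]

/-- On indicators, the head value is below the tail value exactly when the arc leaves `W`. The
accumulator starts at `-width`. -/
theorem runs_evaluate {N : ℕ} {s : Store} {L : List (Arc N ℝ≥0)} (hL : s.Holds L)
    {W : Finset (Fin N)} (hW : ∀ x : Fin N, (x ∈ W → s.side x = 1) ∧ (x ∉ W → s.side x = 0)) :
    Runs O T I Code.evaluate s (4 * L.length + 3) fun s' =>
      ∃ k, s' = { s with idx := k, acc := (cutCapacity L W : ℝ≥0) - I.width } := by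
  refine ((Runs.setReal (Q := fun s' => s' = _) _ (setReal_acc I s _) rfl).seq fun s₁ h₁ =>
    Runs.forIdx (b := 2) (fun j s' => s' =
      { s with idx := j, acc := (cutCapacity (L.take j) W : ℝ≥0) - I.width }) L.length ?_ ?_
      ?_).mono (by omega) fun s' hs' => ⟨_, by rwa [List.take_length] at hs'⟩
  · subst h₁
    simp [RealExp.eval, NatExp.eval, Code.last, cutCapacity, Instance.width]
  · rintro j s' rfl
    simp [hL.ptr_eq]
  · rintro j hj s' rfl
    obtain ⟨h1, h2, h3⟩ := hL.arc_eq j hj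
    have htest : Test.holds (Store.memory I
        { s with idx := j, acc := (cutCapacity (L.take j) W : ℝ≥0) - I.width })
        (.natLt (.get 6 (.get 5 Code.idx)) (.get 6 (.get 4 Code.idx))) ↔
        L[j].tail ∈ W ∧ L[j].head ∉ W := by
      simp only [Test.holds, NatExp.eval, eval_idx]
      change s.side (s.head j) < s.side (s.tail j) ↔ _
      rw [h1, h2]
      by_cases ht : L[j].tail ∈ W <;> by_cases hh : L[j].head ∈ W <;>
        simp [ht, hh, hW]
    rw [cutCapacity_take_succ L W hj]
    refine Runs.ite (b := 1) (fun ht => ?_) fun ht => ?_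
    · rw [htest] at ht
      refine Runs.setReal _ (setReal_acc I _ _) ?_
      simp only [if_pos ht, RealExp.eval, eval_acc, eval_idx, Store.mk.injEq, true_and,
        NNReal.coe_add]
      change _ + s.cap j = _
      rw [h3]
      ring
    · rw [htest] at ht
      exact Runs.skip (by simp [if_neg ht])

theorem runs_copy (s : Store) : Runs O T I Code.copy s (3 * I.n + 3) fun s' =>
    ∃ k out, s' = { s with idx := k, z := s.acc, out := out } ∧ ∀ i < I.n, out i = s.side i := by
  refine ((Runs.setReal (Q := fun s' => s' = _) _ (setReal_z I s _) rfl).seq fun s₁ h₁ =>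
    Runs.forIdx (b := 1) (fun j s' => ∃ out, s' = { s with idx := j, z := s.acc, out := out } ∧
      ∀ i < j, out i = s.side i) I.n ?_ ?_ ?_).mono (by omega) fun s' hs' => ⟨_, hs'⟩
  · exact ⟨s.out, by simp [h₁], by simp⟩
  · rintro j s' ⟨out, rfl, -⟩
    simp
  · rintro j hj s' ⟨out, rfl, hout⟩
    refine Runs.setNat _ (setNat_out I _ _ _) ⟨Function.update out j (s.side j), ?_, ?_⟩
    · simp [NatExp.eval]
      rfl
    · intro i hi
      by_cases hij : i = j
      · simp [hij]
      · simpa [Function.update, hij] using hout i (by omega)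

/-- The incumbent is the best partition that separates `0` from some node in `1, …, j - 1`. -/
def Incumbent (I : Instance) (j : ℕ) (s : Store) : Prop :=
  ∃ S : Finset (Fin I.n), I.first ∈ S ∧ Sᶜ.Nonempty ∧ s.z = I.objective S ∧
    (∀ v : Fin I.n, (v ∈ S → s.out v = 1) ∧ (v ∉ S → s.out v = 0)) ∧
    ∀ t : Fin I.n, 1 ≤ t.val → t.val < j → ∀ S', I.first ∈ S' → t ∉ S' →
      I.objective S ≤ I.objective S'

/-- The test `sink < 2` stands for an infinite initial value: before the first round there is no
incumbent to compare with. -/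
theorem runs_improve {s : Store} {Q : Store → Prop}
    (hcopy : s.sink < 2 ∨ s.acc < s.z → ∀ k out, (∀ i < I.n, out i = s.side i) →
      Q { s with idx := k, z := s.acc, out := out })
    (hkeep : 2 ≤ s.sink → s.z ≤ s.acc → Q s) :
    Runs O T I Code.improve s (3 * I.n + 5) Q := by
  have hc (h : s.sink < 2 ∨ s.acc < s.z) : Runs O T I Code.copy s (3 * I.n + 3) Q := by
    refine (runs_copy s).mono le_rfl ?_
    rintro s' ⟨k, out, rfl, hout⟩
    exact hcopy h k out hout
  refine Runs.ite (fun h1 => ?_) fun h1 => Runs.ite (fun h2 => hc (Or.inr ?_)) fun h2 => ?_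
  · exact (hc (Or.inl (by simpa [Test.holds, NatExp.eval] using h1))).mono (by omega) fun _ h => h
  · simpa [Test.holds] using h2
  · refine (Runs.skip (hkeep ?_ ?_)).mono (by omega) fun _ h => h
    · simpa [Test.holds, NatExp.eval, Nat.succ_le_iff] using h1
    · simpa [Test.holds] using h2

theorem runs_round (hO : IsMinCutProcedure O) {s : Store} (t : Fin I.n) (ht1 : 1 ≤ t.val)
    (hs : s.sink = t) (hinc : 1 < t.val → Incumbent I t s) :
    Runs O T I Code.round s (T (2 * I.m + 9 * I.n) (4 * I.n) + (19 * I.m + 78 * I.n + 14))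
      fun s' => s'.sink = t.val + 1 ∧ Incumbent I (t.val + 1) s' := by
  have htf : t ≠ I.first := by
    rintro rfl
    exact absurd ht1 (by simp [Instance.first])
  obtain ⟨hf, htS, hcap, hmin⟩ := I.trace_minCut hO t htf
  set W := O (I.rangeNetwork t htf) with hW
  set S := I.trace W with hS
  refine ((runs_build s t hs).seq fun s₁ h₁ => (runs_minCut t htf (h₁.1.trans hs) h₁.2.2.2).seq
    fun s₂ h₂ => ?_).mono (b := (11 * I.m + 39 * I.n + 5) + (T (2 * I.m + 9 * I.n) (4 * I.n) +
      ((4 * (2 * I.m + 9 * I.n) + 3) + ((3 * I.n + 5) + 1)))) (by omega) fun _ h => h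
  obtain ⟨hsink, hout, hz, hL⟩ := h₁
  obtain ⟨side, rfl, hside⟩ := h₂
  rw [← I.length_rangeArcs t]
  refine (runs_evaluate (s := { s₁ with side := side }) (L := I.rangeArcs t) (W := W)
    (hL.congr rfl rfl rfl rfl) hside).seq ?_
  rintro _ ⟨k, rfl⟩
  -- The accumulator now holds the objective of the trace.
  rw [hcap, add_sub_cancel_right]
  refine (runs_improve (Q := fun s' => s'.sink = t.val ∧ Incumbent I (t.val + 1) s')
    ?_ ?_).seq ?_
  · rintro hlt k' out hout'
    refine ⟨hsink.trans hs, S, hf, ⟨t, by simpa using htS⟩, rfl, fun v => ?_, ?_⟩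
    · have h1 := hside ⟨v, by omega⟩
      have h2 := hout' v v.isLt
      simp only at h1 h2 ⊢
      rw [h2]
      exact ⟨fun h => h1.1 (I.mem_trace.1 h), fun h => h1.2 fun h' => h (I.mem_trace.2 h')⟩
    · intro t' ht' htlt S' hS' htS'
      obtain htt | htt := Nat.lt_succ_iff_lt_or_eq.1 htlt
      · obtain ⟨S₀, -, -, hz₀, -, hmin₀⟩ := hinc (by omega)
        have h1 : I.objective S < s₁.z := hlt.resolve_left (by simp only; omega)
        rw [hz, hz₀] at h1
        exact h1.le.trans (hmin₀ t' ht' htt S' hS' htS')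
      · obtain rfl : t' = t := Fin.ext htt
        exact hmin S' hS' htS'
  · intro hge hle
    simp only at hge hle
    obtain ⟨S₀, h1, h2, hz₀, hout₀, hmin₀⟩ := hinc (by omega)
    rw [hz, hz₀] at hle
    refine ⟨hsink.trans hs, S₀, h1, h2, hz.trans hz₀, by simpa [hout] using hout₀, ?_⟩
    intro t' ht' htlt S' hS' htS'
    obtain htt | htt := Nat.lt_succ_iff_lt_or_eq.1 htlt
    · exact hmin₀ t' ht' htt S' hS' htS'
    · obtain rfl : t' = t := Fin.ext htt
      exact hle.trans (hmin S' hS' htS')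
  · rintro s₃ ⟨h1, h2⟩
    refine Runs.setNat _ (setNat_sink I _ _) ⟨?_, h2⟩
    simp [NatExp.eval, h1]

theorem runs_main (hO : IsMinCutProcedure O) :
    Runs O T I Code.main Store.empty
      ((I.n - 1) * (T (2 * I.m + 9 * I.n) (4 * I.n) + (19 * I.m + 78 * I.n + 15)) + 2)
      (Incumbent I I.n) := by
  have hn := I.two_le
  refine ((Runs.setNat (Q := fun s' => s'.sink = 1) _ (setNat_sink I _ _) rfl).seq fun s₁ h₁ =>
    (Runs.whileLoop (b := T (2 * I.m + 9 * I.n) (4 * I.n) + (19 * I.m + 78 * I.n + 14))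
      -- Sinks start at `1`, and an incumbent is claimed only after the first round.
      (fun j s' => s'.sink = j + 1 ∧ (0 < j → Incumbent I (j + 1) s')) (I.n - 1)
      ?_ ?_ ⟨h₁, by simp⟩).mono le_rfl (Q' := Incumbent I I.n) ?_).mono ?_ fun _ h => h
  · rintro j hj s ⟨h1, h2⟩
    refine ⟨by simp [Test.holds, h1]; omega, ?_⟩
    refine (runs_round hO ⟨j + 1, by omega⟩ (by simp) h1 fun h => h2 (by simpa using h)).mono
      le_rfl fun s' hs' => ⟨hs'.1, fun _ => hs'.2⟩
  · rintro s ⟨h1, -⟩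
    simp [Test.holds, h1]; omega
  · rintro s ⟨-, h2⟩
    have := h2 (by omega)
    rwa [Nat.sub_add_cancel (by omega)] at this
  · rw [add_assoc, add_assoc (19 * I.m + 78 * I.n)]
    omega

end Program

/-- Two applications of `growth` reach `4n` nodes but only `4m + 8n` arcs, which may be too few; the
third brings the factor to `D ^ 3`. -/
theorem IsCutTime.range_network_le {T : ℕ → ℕ → ℕ} {D : ℕ} (hT : IsCutTime T D) (m n : ℕ) :
    T (2 * m + 9 * n) (4 * n) ≤ D ^ 3 * T m n := by
  have h1 := hT.growth m n
  have h2 := hT.growth (2 * (m + n)) (2 * n)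
  have h3 := hT.growth (2 * (2 * (m + n) + 2 * n)) (2 * (2 * n))
  have h4 := hT.mono (2 * m + 9 * n) (2 * (2 * (2 * (m + n) + 2 * n) + 2 * (2 * n))) (4 * n)
    (2 * (2 * (2 * n))) (by omega) (by omega)
  calc _ ≤ _ := h4
    _ ≤ _ := h3
    _ ≤ D * (D * (D * T m n)) :=
      Nat.mul_le_mul_left D (h2.trans (Nat.mul_le_mul_left D h1))
    _ = _ := by ring

theorem main_spec (D : ℕ) {T : ℕ → ℕ → ℕ} (hT : IsCutTime T D)
    {O : (N : STNetwork) → Finset (Fin N.nodes)} (hO : IsMinCutProcedure O) (I : Instance) :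
    ∃ (σ : Memory) (c : ℕ) (S : Finset (Fin I.n)) (z : ℝ),
      Exec O T Code.main I.input c σ ∧ I.IsOutput σ S z ∧
      I.IsMinRangeCut S ∧ z = I.objective S ∧ c ≤ (D ^ 3 + 100) * (I.n * T I.m I.n) := by
  have hn := I.two_le
  obtain ⟨c, s, hexec, hc, S, hf, hne, hz, hout, hmin⟩ := runs_main (T := T) (I := I) hO
  refine ⟨s.memory I, c, S, s.z, memory_empty I ▸ hexec, ⟨hout, ?_⟩, ?_, hz, hc.trans ?_⟩
  · simp [Store.memory]
  · refine I.isMinRangeCut_of_first_mem ⟨_, hf⟩ hne fun S' hS' hne' => ?_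
    -- Every competitor misses some node `t ≥ 1`, hence was beaten in the round with sink `t`.
    obtain ⟨t, ht, ht1, -⟩ := I.exists_min_notMem hne' hS'
    exact hmin t ht1 t.isLt S' hS' ht
  · have h1 := hT.range_network_le I.m I.n
    have h2 := hT.size_le I.m I.n
    have h3 : T (2 * I.m + 9 * I.n) (4 * I.n) + (19 * I.m + 78 * I.n + 15) + 1 ≤
        (D ^ 3 + 100) * T I.m I.n := by
      rw [add_mul]
      omega
    -- The two steps outside the rounds are absorbed by `2 ≤ n`.
    calc _ ≤ I.n * (T (2 * I.m + 9 * I.n) (4 * I.n) + (19 * I.m + 78 * I.n + 15)) + I.n :=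
          Nat.add_le_add (Nat.mul_le_mul_right _ (by omega)) hn
      _ = I.n * (T (2 * I.m + 9 * I.n) (4 * I.n) + (19 * I.m + 78 * I.n + 15) + 1) := by ring
      _ ≤ I.n * ((D ^ 3 + 100) * T I.m I.n) := Nat.mul_le_mul_left _ h3
      _ = _ := by ring

end RangeCut

theorem mainTheorem1 :
    -- the Min Range Cut Algorithm, with an arbitrary parametric cut procedure
    (∃ C₀ : ℕ, ∀ D K : ℕ, ∃ C : ℕ,
      ∀ (P : RangeCut.ParamCutProcedure), P.Correct → ∀ I : RangeCut.Instance,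
        ∃ (S : Finset (Fin I.n)) (z : ℝ) (L : RangeCut.Ledger),
          (RangeCut.minRangeCutAlgorithm I P).run RangeCut.Ledger.empty = (some (S, z), L) ∧
          I.IsMinRangeCut S ∧ z = I.objective S ∧
          L.calls.length ≤ 2 * I.n ∧
          (L.calls.map RangeCut.CallSize.values).sum ≤ I.n ^ 2 ∧
          (∀ c ∈ L.calls, c.nodes = I.n ∧ c.arcs ≤ 2 * (I.m + I.n) ∧ c.values ≤ I.n) ∧
          L.ownSteps ≤ C₀ * (I.n * (I.m + I.n)) ∧
          ∀ T : ℕ → ℕ → ℕ, RangeCut.IsCutTime T D →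
            (∀ (n q : ℕ) (G : RangeCut.ParamNetwork n q), G.IsParametric → q ≤ n →
              P.time G ≤ K * T G.arcs.length n) →
            L.steps ≤ C * (I.n * T I.m I.n)) ∧
    -- running time in terms of the cost of one minimum `s,t`-cut, for every such procedure
    (∃ p : RangeCut.Program, ∀ D : ℕ, ∃ C : ℕ,
      ∀ T : ℕ → ℕ → ℕ, RangeCut.IsCutTime T D →
      ∀ O : (N : RangeCut.STNetwork) → Finset (Fin N.nodes), RangeCut.IsMinCutProcedure O →
      ∀ I : RangeCut.Instance,
        ∃ (σ : RangeCut.Memory) (c : ℕ) (S : Finset (Fin I.n)) (z : ℝ),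
          RangeCut.Exec O T p I.input c σ ∧ I.IsOutput σ S z ∧
          I.IsMinRangeCut S ∧ z = I.objective S ∧
          c ≤ C * (I.n * T I.m I.n)) := by
  refine ⟨RangeCut.minRangeCutAlgorithm_spec, RangeCut.Code.main, fun D => ⟨D ^ 3 + 100, ?_⟩⟩
  intro T hT O hO I
  exact RangeCut.main_spec D hT hO I
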